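/- Let $\Bbbk\le\Bbbk'$ be a field extension, and let $(-)_{\Bbbk'}=-\otimes_{\Bbbk}\Bbbk'$ denote each of the scalar extension functors ${}_{\Bbbk}\mathrm{Coalg}\to{}_{\Bbbk'}\mathrm{Coalg}$, ${}_{\Bbbk}\mathrm{BiAlg}\to{}_{\Bbbk'}\mathrm{BiAlg}$ and ${}_{\Bbbk}\mathrm{HAlg}\to{}_{\Bbbk'}\mathrm{HAlg}$ between the categories of (counital, coassociative) coalgebras, of bialgebras and of Hopf algebras over $\Bbbk$ and $\Bbbk'$, with products and powers taken in the respective category (a power of $X$ being a product of copies of $X$). The following conditions are equivalent. (a) The extension $\Bbbk\le\Bbbk'$ is algebraic. (b) $(-)_{\Bbbk'}:{}_{\Bbbk}\mathrm{Coalg}\to{}_{\Bbbk'}\mathrm{Coalg}$ preserves finite (equivalently, binary) products of finite-dimensional coalgebras. (c) $(-)_{\Bbbk'}:{}_{\Bbbk}\mathrm{Coalg}\to{}_{\Bbbk'}\mathrm{Coalg}$ preserves finite limits or, equivalently, finite products or, equivalently, binary products. (d) $(-)_{\Bbbk'}:{}_{\Bbbk}\mathrm{Coalg}\to{}_{\Bbbk'}\mathrm{Coalg}$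 preserves finite (equivalently, binary) powers. (e) The analogue of (c) (in each of its three forms) for bialgebras; equivalently, for Hopf algebras. (f) The analogue of (d) (in each of its two forms) for bialgebras; equivalently, for Hopf algebras. (g) $(-)_{\Bbbk'}:{}_{\Bbbk}\mathrm{HAlg}\to{}_{\Bbbk'}\mathrm{HAlg}$ preserves the binary power $H\times H$ of some Hopf $\Bbbk$-algebra $H$ of finite dimension $>1$. (h) $(-)_{\Bbbk'}:{}_{\Bbbk}\mathrm{Coalg}\to{}_{\Bbbk'}\mathrm{Coalg}$ preserves the binary power $C\times C$ of some $\Bbbk$-coalgebra $C$ of finite dimension $>1$. -/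

import Mathlib

open CategoryTheory CategoryTheory.Limits TensorProduct

universe u

namespace ScalarExt

section Functors

variable (k k' : Type u) [Field k] [Field k'] [Algebra k k']

/-- Scalar extension `C ↦ k' ⊗[k] C` from `k`-coalgebras to `k'`-coalgebras, where `k' ⊗[k] C`
carries the base-changed comultiplication and counit. -/
noncomputable def coalg : CoalgCat.{u} k ⥤ CoalgCat.{u} k' where
  obj C := CoalgCat.of k' (k' ⊗[k] C)
  map f := CoalgCat.ofHom (Coalgebra.TensorProduct.map (CoalgHom.id k' k') f.toCoalgHom)
  map_id C := by
    apply CoalgCat.hom_ext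
    apply CoalgHom.coe_linearMap_injective
    ext x
    rfl
  map_comp f g := by
    apply CoalgCat.hom_ext
    apply CoalgHom.coe_linearMap_injective
    ext x
    rfl

theorem bialg_map_id (B : Type u) [Ring B] [Bialgebra k B] :
    Bialgebra.TensorProduct.map (BialgHom.id k' k') (BialgHom.id k B) =
      BialgHom.id k' (k' ⊗[k] B) := by
  apply BialgHom.coe_toAlgHom_injective
  apply Algebra.TensorProduct.ext'
  intro a b
  rfl

theorem bialg_map_comp (A B C : Type u) [Ring A] [Bialgebra k A] [Ring B] [Bialgebra k B]
    [Ring C] [Bialgebra k C] (f : A →ₐc[k] B) (g : B →ₐc[k] C) :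
    Bialgebra.TensorProduct.map (BialgHom.id k' k') (g.comp f) =
      (Bialgebra.TensorProduct.map (BialgHom.id k' k') g).comp
        (Bialgebra.TensorProduct.map (BialgHom.id k' k') f) := by
  apply BialgHom.coe_toAlgHom_injective
  apply Algebra.TensorProduct.ext'
  intro a b
  rfl

/-- Scalar extension `B ↦ k' ⊗[k] B` from `k`-bialgebras to `k'`-bialgebras. -/
noncomputable def bialg : BialgCat.{u} k ⥤ BialgCat.{u} k' where
  obj B := BialgCat.of k' (k' ⊗[k] B)
  map f := BialgCat.ofHom (Bialgebra.TensorProduct.map (BialgHom.id k' k') f.toBialgHom)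
  map_id X := BialgCat.hom_ext _ _ (bialg_map_id k k' X)
  map_comp {X Y Z} f g := BialgCat.hom_ext _ _
    (bialg_map_comp k k' X Y Z f.toBialgHom g.toBialgHom)

/-- Scalar extension `H ↦ k' ⊗[k] H` from Hopf `k`-algebras to Hopf `k'`-algebras. -/
noncomputable def hopf : HopfAlgCat.{u} k ⥤ HopfAlgCat.{u} k' where
  obj H := HopfAlgCat.of k' (k' ⊗[k] H)
  map f := HopfAlgCat.ofHom (Bialgebra.TensorProduct.map (BialgHom.id k' k') f.toBialgHom)
  map_id X := HopfAlgCat.hom_ext _ _ (bialg_map_id k k' X)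
  map_comp {X Y Z} f g := HopfAlgCat.hom_ext _ _
    (bialg_map_comp k k' X Y Z f.toBialgHom g.toBialgHom)

end Functors

section Preservation

variable {C D : Type*} [Category C] [Category D]

/-- `F` preserves binary products. -/
def PreservesBinaryProducts (F : C ⥤ D) : Prop :=
  ∀ X Y : C, PreservesLimit (pair X Y) F

/-- `F` preserves the binary power `X × X` of the object `X`. -/
def PreservesBinaryPower (F : C ⥤ D) (X : C) : Prop :=
  PreservesLimit (pair X X) F

/-- `F` preserves binary powers, i.e. the products `X × X`. -/
def PreservesBinaryPowers (F : C ⥤ D) : Prop :=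
  ∀ X : C, PreservesBinaryPower F X

/-- `F` preserves finite powers, i.e. the products of finite families with all members equal. -/
def PreservesFinitePowers (F : C ⥤ D) : Prop :=
  ∀ (ι : Type) [Finite ι] (X : C), PreservesLimit (Discrete.functor fun _ : ι => X) F

end Preservation

end ScalarExt

/-! The main tool is duality. Functionals on a `k`-coalgebra `C` form the convolution algebra `C*`,
and a `k'`-coalgebra map `D → k' ⊗ C` is determined by its transpose, a `k`-algebra map from `C*` to
the `k'`-dual `D*`. For finite-dimensional `D` the transpose sees only the restriction of
functionals to a finite-dimensional subspace of `C`, so its image is finite-dimensional over `k`.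

Algebraic extensions preserve finite limits. Given finitely many maps `D → k' ⊗ C i` with `D`
finite-dimensional, the images of their transposes lie in one finite-dimensional `k`-subalgebra `A`
of `D*`: the structure constants and coordinates involved are finitely many algebraic elements
(`exists_subalgebra_finite`). Dualizing, all the maps factor through a single `D → k' ⊗ Aᵛ` by maps
`Aᵛ → C i` over `k`, and uniquely so (`exists_common_factor`). Hence a cone with finite-dimensional
apex over the extended diagram descends to `k` and lifts uniquely to the extended limit. Every
coalgebra is the union of its finite-dimensional subcoalgebras (`exists_finite_subcoalgebra`), so
the comparison map is bijective (`preservesLimit_of_isAlgebraic`).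

Conversely, let `C` have finite dimension greater than one and let `t` be in `k'`. Put `A = C*` and
let `A` act on `k' ⊗ A` by its regular representation and by a conjugate of it under a transvection
depending on `t`. For a suitable `a` the product of the two images of `a` has trace `c - t ^ 2` with
`c` in `k`. If `C × C` is preserved, the two representations factor through one finite map out of
`(C × C)*`, so that product lies in a finite-dimensional `k`-algebra; it is integral, hence so is
its trace, and `t` is algebraic (`isAlgebraic_of_preservesBinaryPower`).

Bialgebras are the monoid objects of coalgebras, so forgetting to coalgebras creates limits. A
bialgebra limit of Hopf algebras has an antipode (`exists_antipode`), so limits of Hopf algebras are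
created too. Preservation can therefore be tested on underlying coalgebras
(`preservesLimit_iff_of_createsLimit`), and the group algebra of the group of order two supplies the
witness of dimension greater than one. -/

namespace ScalarExt

open Coalgebra WithConv LinearMap

/-! ### Separating families of functionals on tensor products. -/

section Separation

variable {k V W : Type*} [Field k] [AddCommGroup V] [Module k V] [AddCommGroup W] [Module k W]

/-- A family of linear functionals that detects zero. -/
def Separates {ι : Type*} (f : ι → V →ₗ[k] k) : Prop := ∀ v, (∀ i, f i v = 0) → v = 0

theorem separates_all : Separates (fun f : V →ₗ[k] k => f) := fun v h =>
  (Module.forall_dual_apply_eq_zero_iff k v).1 h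

theorem Separates.eq {ι : Type*} {f : ι → V →ₗ[k] k} (hf : Separates f) {v w : V}
    (h : ∀ i, f i v = f i w) : v = w :=
  sub_eq_zero.1 (hf _ fun i => by simp [h i])

/-- In a basis of `V`, an element of `V ⊗ W` is a finitely supported family in `W`, and the slices
by `g j` apply `g j` to each member. -/
theorem rid_lTensor_separates {κ : Type*} {g : κ → W →ₗ[k] k} (hg : Separates g) (z : V ⊗[k] W)
    (h : ∀ j, TensorProduct.rid k V ((g j).lTensor V z) = 0) : z = 0 := by
  classical
  let b := Module.Basis.ofVectorSpace k V
  have key (j) (i) : b.repr (TensorProduct.rid k V ((g j).lTensor V z)) i =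
      g j (TensorProduct.equivFinsuppOfBasisLeft b z i) := by
    clear h
    induction z with
    | zero => simp
    | add x y hx hy => simp only [map_add, Finsupp.add_apply, hx, hy]
    | tmul v w => simp [mul_comm]
  apply (TensorProduct.equivFinsuppOfBasisLeft b).injective
  ext i
  rw [map_zero]
  exact hg _ fun j => by rw [← key, h]; simp

theorem lid_rTensor_separates {κ : Type*} {g : κ → V →ₗ[k] k} (hg : Separates g) (z : V ⊗[k] W)
    (h : ∀ j, TensorProduct.lid k W ((g j).rTensor W z) = 0) : z = 0 := by
  apply (TensorProduct.comm k V W).injective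
  rw [map_zero]
  refine rid_lTensor_separates hg _ fun j => ?_
  rw [← h j]
  clear h
  induction z with
  | zero => simp
  | add x y hx hy => simp only [map_add, hx, hy]
  | tmul v w => simp

/-- The functional `v ⊗ w ↦ f v * g w` on a tensor product. -/
noncomputable def pairing (f : V →ₗ[k] k) (g : W →ₗ[k] k) : V ⊗[k] W →ₗ[k] k :=
  LinearMap.mul' k k ∘ₗ TensorProduct.map f g

@[simp]
theorem pairing_tmul (f : V →ₗ[k] k) (g : W →ₗ[k] k) (v : V) (w : W) :
    pairing f g (v ⊗ₜ w) = f v * g w := rfl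

theorem pairing_map {V' W' : Type*} [AddCommGroup V'] [Module k V'] [AddCommGroup W'] [Module k W']
    (f : V →ₗ[k] k) (g : W →ₗ[k] k) (u : V' →ₗ[k] V) (v : W' →ₗ[k] W) (z : V' ⊗[k] W') :
    pairing f g (TensorProduct.map u v z) = pairing (f ∘ₗ u) (g ∘ₗ v) z := by
  rw [pairing, pairing, TensorProduct.map_comp]
  rfl

theorem pairing_lTensor {U : Type*} [AddCommGroup U] [Module k U] (f : V →ₗ[k] k) (g : W →ₗ[k] k)
    (h : U →ₗ[k] W) (z : V ⊗[k] U) : pairing f g (h.lTensor V z) = pairing f (g ∘ₗ h) z :=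
  pairing_map f g LinearMap.id h z

theorem pairing_rTensor {U : Type*} [AddCommGroup U] [Module k U] (f : V →ₗ[k] k) (g : W →ₗ[k] k)
    (h : U →ₗ[k] V) (z : U ⊗[k] W) : pairing f g (h.rTensor W z) = pairing (f ∘ₗ h) g z :=
  pairing_map f g h LinearMap.id z

theorem pairing_assoc {U : Type*} [AddCommGroup U] [Module k U] (f : V →ₗ[k] k) (g : W →ₗ[k] k)
    (h : U →ₗ[k] k) (z : (V ⊗[k] W) ⊗[k] U) :
    pairing f (pairing g h) (TensorProduct.assoc k V W U z) = pairing (pairing f g) h z := by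
  rw [← LinearEquiv.coe_coe, ← LinearMap.comp_apply]
  congr 1
  ext
  simp [mul_assoc]

theorem convMul_apply_eq_pairing [Coalgebra k V] (f g : WithConv (V →ₗ[k] k)) (v : V) :
    (f * g) v = pairing f.ofConv g.ofConv (comul v) := rfl

theorem separates_pairing {ι κ : Type*} {f : ι → V →ₗ[k] k} {g : κ → W →ₗ[k] k} (hf : Separates f)
    (hg : Separates g) : Separates fun p : ι × κ => pairing (f p.1) (g p.2) := by
  intro z h
  refine rid_lTensor_separates hg z fun j => hf _ fun i => ?_
  rw [← h (i, j)]
  clear h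
  induction z with
  | zero => simp
  | add x y hx hy => simp only [map_add, hx, hy]
  | tmul v w => simp [mul_comm]

end Separation

/-! ### Functionals on scalar extensions and transposes of coalgebra maps. -/

section Extension

variable {k k' C D : Type*} [Field k] [Field k'] [Algebra k k'] [AddCommGroup C] [Module k C]
  [AddCommGroup D] [Module k' D]

/-- The `k'`-linear extension of a `k`-linear functional. -/
noncomputable def extDual (k' : Type*) [Field k'] [Algebra k k'] (f : C →ₗ[k] k) :
    k' ⊗[k] C →ₗ[k'] k' :=
  (AlgebraTensorModule.rid k k' k').toLinearMap ∘ₗ f.baseChange k'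

@[simp]
theorem extDual_tmul (f : C →ₗ[k] k) (a : k') (c : C) : extDual k' f (a ⊗ₜ c) = f c • a := rfl

theorem extDual_add (f g : C →ₗ[k] k) : extDual k' (f + g) = extDual k' f + extDual k' g := by
  ext; simp [add_smul]

theorem extDual_smul (a : k) (f : C →ₗ[k] k) : extDual k' (a • f) = a • extDual k' f := by
  ext; simp [mul_smul]

theorem extDual_baseChange {E : Type*} [AddCommGroup E] [Module k E] (f : C →ₗ[k] k)
    (g : E →ₗ[k] C) : extDual k' f ∘ₗ g.baseChange k' = extDual k' (f ∘ₗ g) := by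
  ext; simp

/-- Functionals defined over `k` already detect elements of `k' ⊗ C`, so a map into a scalar
extension can be tested on them alone. -/
theorem separates_extDual : Separates (extDual k' : (C →ₗ[k] k) → _) := by
  intro z h
  refine rid_lTensor_separates (k := k) separates_all z fun f => ?_
  rw [← h f]
  clear h
  induction z with
  | zero => simp
  | add x y hx hy => simp only [map_add, hx, hy]
  | tmul v w => simp

variable [Coalgebra k C] [Coalgebra k' D]

theorem extDual_mul (f g : WithConv (C →ₗ[k] k)) :
    toConv (extDual k' (f * g).ofConv) =
      toConv (extDual k' f.ofConv) * toConv (extDual k' g.ofConv) := by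
  ext c
  simp only [LinearMap.convMul_def, AlgebraTensorModule.curry_apply, coe_comp,
    curry_apply, Function.comp_apply, coe_restrictScalars, extDual_tmul, TensorProduct.comul_tmul,
    CommSemiring.comul_apply]
  generalize (comul c : C ⊗[k] C) = z
  induction z with
  | zero => simp
  | add x y hx hy => simp only [map_add, add_smul, tmul_add, hx, hy]
  | tmul v w => simp [Algebra.smul_def]

theorem extDual_one : toConv (extDual k' (1 : WithConv (C →ₗ[k] k)).ofConv) = 1 := by
  ext c
  simp [LinearMap.convOne_def]

/-- Pulling back functionals along a coalgebra map into a scalar extension. -/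
noncomputable def transpose (φ : D →ₗc[k'] k' ⊗[k] C) :
    WithConv (C →ₗ[k] k) →ₐ[k] WithConv (D →ₗ[k'] k') :=
  AlgHom.ofLinearMap
    { toFun := fun f => toConv (extDual k' f.ofConv ∘ₗ φ.toLinearMap)
      map_add' := fun f g => by
        simp only [ofConv_add, extDual_add, LinearMap.add_comp, toConv_add]
      map_smul' := fun a f => by
        simp only [ofConv_smul, extDual_smul, LinearMap.smul_comp, toConv_smul, RingHom.id_apply] }
    (by
      simp only [coe_mk, AddHom.coe_mk]
      rw [← ofConv_toConv (extDual k' (1 : WithConv (C →ₗ[k] k)).ofConv), extDual_one]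
      ext d
      simp [LinearMap.convOne_def])
    (fun f g => by
      simp only [coe_mk, AddHom.coe_mk]
      rw [← ofConv_toConv (extDual k' (f * g).ofConv), extDual_mul, convMul_comp_coalgHom_distrib])

@[simp]
theorem transpose_apply (φ : D →ₗc[k'] k' ⊗[k] C) (f : WithConv (C →ₗ[k] k)) (d : D) :
    transpose φ f d = extDual k' f.ofConv (φ d) := rfl

/-- A linear map into a scalar extension whose transpose is multiplicative is a coalgebra map. -/
noncomputable def coalgHomOfTranspose (φ : D →ₗ[k'] k' ⊗[k] C)
    (h1 : toConv (extDual k' (1 : WithConv (C →ₗ[k] k)).ofConv ∘ₗ φ) = 1)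
    (hmul : ∀ f g : WithConv (C →ₗ[k] k), toConv (extDual k' (f * g).ofConv ∘ₗ φ) =
      toConv (extDual k' f.ofConv ∘ₗ φ) * toConv (extDual k' g.ofConv ∘ₗ φ)) :
    D →ₗc[k'] k' ⊗[k] C where
  toLinearMap := φ
  counit_comp := by
    have := congrArg ofConv h1
    rw [← ofConv_toConv (extDual k' (1 : WithConv (C →ₗ[k] k)).ofConv), extDual_one] at this
    exact this
  map_comp_comul := by
    ext d
    refine (separates_pairing (separates_extDual (k := k)) (separates_extDual (k := k))).eq
      fun ⟨f, g⟩ => ?_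
    have := congr($(hmul (toConv f) (toConv g)) d)
    rw [← ofConv_toConv (extDual k' (toConv f * toConv g).ofConv), extDual_mul] at this
    rw [convMul_apply_eq_pairing] at this
    simp only [coe_comp, Function.comp_apply, pairing_map]
    exact this.symm

/-- A linear map of coalgebras over a field whose transpose is multiplicative is a
coalgebra map. -/
noncomputable def coalgHomOfDual {E : Type*} [AddCommGroup E] [Module k E] [Coalgebra k E]
    (φ : E →ₗ[k] C) (h1 : toConv ((1 : WithConv (C →ₗ[k] k)).ofConv ∘ₗ φ) = 1)
    (hmul : ∀ f g : WithConv (C →ₗ[k] k), toConv ((f * g).ofConv ∘ₗ φ) =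
      toConv (f.ofConv ∘ₗ φ) * toConv (g.ofConv ∘ₗ φ)) : E →ₗc[k] C where
  toLinearMap := φ
  counit_comp := congrArg ofConv h1
  map_comp_comul := by
    ext d
    refine (separates_pairing separates_all separates_all).eq fun ⟨f, g⟩ => ?_
    have := congr($(hmul (toConv f) (toConv g)) d)
    rw [convMul_apply_eq_pairing] at this
    simp only [coe_comp, Function.comp_apply, pairing_map]
    exact this.symm

end Extension

/-! ### The dual coalgebra of a finite-dimensional algebra. -/

section DualCoalgebra

variable {k A : Type*} [Field k] [Ring A] [Algebra k A] [FiniteDimensional k A]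

omit [FiniteDimensional k A] in
theorem separates_eval : Separates (Module.Dual.eval k A) := fun _ h => LinearMap.ext h

noncomputable instance dualCoalgebraStruct : CoalgebraStruct k (Module.Dual k A) where
  comul := (TensorProduct.dualDistribEquiv k A A).symm.toLinearMap ∘ₗ (LinearMap.mul' k A).dualMap
  counit := Module.Dual.eval k A 1

omit [FiniteDimensional k A] in
theorem pairing_eval_eval (a b : A) (z : Module.Dual k A ⊗[k] Module.Dual k A) :
    pairing (Module.Dual.eval k A a) (Module.Dual.eval k A b) z =
      TensorProduct.dualDistrib k A A z (a ⊗ₜ b) := by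
  induction z with
  | zero => simp
  | add x y hx hy => simp only [map_add, hx, hy, LinearMap.add_apply]
  | tmul v w => simp

theorem pairing_eval_comul (a b : A) (ρ : Module.Dual k A) :
    pairing (Module.Dual.eval k A a) (Module.Dual.eval k A b) (comul ρ) = ρ (a * b) := by
  rw [pairing_eval_eval]
  change (TensorProduct.dualDistribEquiv k A A) ((TensorProduct.dualDistribEquiv k A A).symm _) _ = _
  rw [LinearEquiv.apply_symm_apply]
  simp

theorem pairing_eval_comp_comul (a b : A) :
    pairing (Module.Dual.eval k A a) (Module.Dual.eval k A b) ∘ₗ comul =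
      Module.Dual.eval k A (a * b) :=
  LinearMap.ext fun ρ => pairing_eval_comul a b ρ

/-- The dual of a finite-dimensional algebra is a coalgebra. -/
noncomputable instance dualCoalgebra : Coalgebra k (Module.Dual k A) where
  -- Tested on evaluations at `a`, `b`, `c`, coassociativity becomes associativity of `A`.
  coassoc := by
    ext1 ρ
    refine (separates_pairing separates_eval (separates_pairing separates_eval
      separates_eval)).eq fun ⟨a, b, c⟩ => ?_
    simp only [coe_comp, Function.comp_apply, LinearEquiv.coe_coe, pairing_assoc, pairing_lTensor,
      pairing_rTensor]
    rw [pairing_eval_comp_comul, pairing_eval_comp_comul, pairing_eval_comul, pairing_eval_comul,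
      mul_assoc]
  rTensor_counit_comp_comul := by
    ext1 ρ
    refine (separates_pairing separates_all separates_eval).eq fun ⟨f, a⟩ => ?_
    have : f ∘ₗ counit = Module.Dual.eval k A (algebraMap k A (f 1)) := by
      ext ρ
      have : f (ρ 1) = ρ 1 • f 1 := by rw [← map_smul, smul_eq_mul, mul_one]
      simpa [Algebra.algebraMap_eq_smul_one, counit, mul_comm (f 1)] using this
    simp only [coe_comp, Function.comp_apply, pairing_rTensor]
    rw [this, pairing_eval_comul]
    simp [Algebra.algebraMap_eq_smul_one]
  lTensor_counit_comp_comul := by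
    ext1 ρ
    refine (separates_pairing separates_eval separates_all).eq fun ⟨a, f⟩ => ?_
    have : f ∘ₗ counit = Module.Dual.eval k A (algebraMap k A (f 1)) := by
      ext ρ
      have : f (ρ 1) = ρ 1 • f 1 := by rw [← map_smul, smul_eq_mul, mul_one]
      simpa [Algebra.algebraMap_eq_smul_one, counit, mul_comm (f 1)] using this
    simp only [coe_comp, Function.comp_apply, pairing_lTensor]
    rw [this, pairing_eval_comul]
    simp [Algebra.algebraMap_eq_smul_one, mul_comm]

theorem counit_dual (ρ : Module.Dual k A) : counit (R := k) ρ = ρ 1 := rfl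

/-- A finite-dimensional algebra is the convolution algebra of its dual coalgebra. -/
noncomputable def evalAlgEquiv (k A : Type*) [Field k] [Ring A] [Algebra k A]
    [FiniteDimensional k A] : A ≃ₐ[k] WithConv (Module.Dual k A →ₗ[k] k) :=
  AlgEquiv.ofLinearEquiv ((Module.evalEquiv k A).trans (WithConv.linearEquiv k _).symm)
    (by ext ρ; simp [counit_dual])
    (fun a b => by ext ρ; exact (pairing_eval_comul a b ρ).symm)

end DualCoalgebra

/-! ### Coalgebra maps into and out of dual coalgebras. -/

section Maps

variable {k k' C D A : Type*} [Field k] [Field k'] [Algebra k k'] [AddCommGroup C] [Module k C]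
  [Coalgebra k C] [AddCommGroup D] [Module k' D] [Coalgebra k' D] [Ring A] [Algebra k A]
  [FiniteDimensional k A]

/-- The coalgebra map to a dual coalgebra given by an algebra map into the convolution algebra. -/
noncomputable def toDualAux (j : A →ₐ[k] WithConv (D →ₗ[k'] k')) :
    D →ₗ[k'] k' ⊗[k] Module.Dual k A where
  toFun d := ∑ i, (j (Module.finBasis k A i)) d ⊗ₜ (Module.finBasis k A).coord i
  map_add' x y := by simp [add_tmul, Finset.sum_add_distrib]
  map_smul' a x := by simp [Finset.smul_sum, TensorProduct.smul_tmul']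

theorem extDual_toDualAux (j : A →ₐ[k] WithConv (D →ₗ[k'] k')) (a : A) :
    toConv (extDual k' (evalAlgEquiv k A a).ofConv ∘ₗ toDualAux j) = j a := by
  conv_rhs => rw [← (Module.finBasis k A).sum_repr a, map_sum]
  ext d
  simp [toDualAux, evalAlgEquiv, map_smul, -Module.Basis.sum_repr]

/-- The coalgebra map `D → k' ⊗ Aᵛ` given by an algebra map from a finite-dimensional algebra `A`
into the convolution algebra of `D`. -/
noncomputable def toDual (j : A →ₐ[k] WithConv (D →ₗ[k'] k')) :
    D →ₗc[k'] k' ⊗[k] Module.Dual k A :=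
  coalgHomOfTranspose (toDualAux j)
    (by rw [← map_one (evalAlgEquiv k A), extDual_toDualAux, map_one])
    (fun f g => by
      obtain ⟨a, rfl⟩ := (evalAlgEquiv k A).surjective f
      obtain ⟨b, rfl⟩ := (evalAlgEquiv k A).surjective g
      rw [← map_mul (evalAlgEquiv k A), extDual_toDualAux, extDual_toDualAux, extDual_toDualAux,
        map_mul])

theorem transpose_toDual (j : A →ₐ[k] WithConv (D →ₗ[k'] k')) (a : A) :
    transpose (toDual j) (evalAlgEquiv k A a) = j a :=
  extDual_toDualAux j a

theorem transpose_toDual' (j : A →ₐ[k] WithConv (D →ₗ[k'] k'))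
    (f : WithConv (Module.Dual k A →ₗ[k] k)) :
    transpose (toDual j) f = j ((evalAlgEquiv k A).symm f) := by
  rw [← transpose_toDual j, AlgEquiv.apply_symm_apply]

/-- An algebra map on the convolution algebra of `C` is finite if it only depends on the
restriction of functionals to some finite-dimensional subspace of `C`. -/
def IsFinite {B : Type*} [Ring B] [Algebra k B] (θ : WithConv (C →ₗ[k] k) →ₐ[k] B) : Prop :=
  ∃ W : Submodule k C, FiniteDimensional k W ∧
    ∀ f : WithConv (C →ₗ[k] k), (∀ w ∈ W, f w = 0) → θ f = 0

/-- A finite algebra map from the convolution algebra of `C` to `A` is induced by a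
map `Aᵛ → C`. -/
theorem exists_fromDual (θ : WithConv (C →ₗ[k] k) →ₐ[k] A) (hθ : IsFinite θ) :
    ∃ ψ : Module.Dual k A →ₗc[k] C, ∀ (f : WithConv (C →ₗ[k] k)) (ρ : Module.Dual k A),
      f (ψ ρ) = ρ (θ f) := by
  obtain ⟨W, hW, h⟩ := hθ
  obtain ⟨p, hp⟩ := W.subtype.exists_leftInverse_of_injective W.ker_subtype
  let b := Module.finBasis k W
  -- The transpose of `θ` lands a priori in the double dual of `C`. Since `θ` sees only the
  -- restriction to `W`, a projection `p` onto `W` and a basis of `W` realize it inside `C`.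
  let ψ : Module.Dual k A →ₗ[k] C :=
    ∑ i, (Module.Dual.eval k A (θ (toConv (b.coord i ∘ₗ p)))).smulRight (b i : C)
  have key (f : WithConv (C →ₗ[k] k)) (ρ : Module.Dual k A) : f (ψ ρ) = ρ (θ f) := by
    have e : θ f = θ (∑ i, f (b i) • toConv (b.coord i ∘ₗ p)) := by
      rw [← sub_eq_zero, ← map_sub]
      refine h _ fun w hw => ?_
      have hpw : p w = ⟨w, hw⟩ := congr($hp ⟨w, hw⟩)
      have := congrArg (f.ofConv ∘ₗ W.subtype) (b.sum_repr ⟨w, hw⟩)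
      simp only [map_sum, map_smul, coe_comp, Function.comp_apply, Submodule.subtype_apply] at this
      simp [hpw, ← this, mul_comm, -Module.Basis.sum_repr]
    rw [e]
    simp [ψ, mul_comm]
  refine ⟨coalgHomOfDual ψ ?_ fun f g => ?_, key⟩
  · ext ρ
    exact (key 1 ρ).trans (by rw [map_one]; rfl)
  · ext ρ
    refine (key (f * g) ρ).trans ?_
    rw [map_mul, convMul_apply_eq_pairing, ← pairing_eval_comul]
    congr 2
    · ext ρ; exact (key f ρ).symm
    · ext ρ; exact (key g ρ).symm

end Maps

/-- The vectors of `B` whose coordinates lie in a finite subextension `F` form a finite-dimensional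
`k`-algebra as soon as `F` contains the structure constants and the coordinates of `1`. Algebraicity
is what makes a finitely generated `F` finite over `k`. -/
theorem exists_subalgebra_finite {k k' : Type*} {B : Type u} [Field k] [Field k'] [Algebra k k'] [Ring B]
    [Algebra k B] [Algebra k' B] [IsScalarTower k k' B] [FiniteDimensional k' B]
    [Algebra.IsAlgebraic k k'] {s : Set B} (hs : s.Finite) :
    ∃ (A : Type u) (_ : Ring A) (_ : Algebra k A) (_ : FiniteDimensional k A) (j : A →ₐ[k] B),
      Function.Injective j ∧ s ⊆ Set.range j := by
  classical
  let b := Module.finBasis k' B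
  let t : Set k' := (⋃ i, ⋃ j, Set.range (b.repr (b i * b j))) ∪ Set.range (b.repr 1) ∪
    ⋃ x ∈ s, Set.range (b.repr x)
  have ht : t.Finite := by
    refine ((Set.finite_iUnion fun i => Set.finite_iUnion fun j => Set.finite_range _).union
      (Set.finite_range _)).union (hs.biUnion fun x _ => Set.finite_range _)
  let F : Subalgebra k k' := Algebra.adjoin k t
  have hF : FiniteDimensional k F :=
    Module.Finite.iff_fg.2 (fg_adjoin_of_finite ht fun x _ => Algebra.IsIntegral.isIntegral x)
  have htF : t ⊆ F := Algebra.subset_adjoin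
  have hmul (i j l) : b.repr (b i * b j) l ∈ F :=
    htF (Or.inl (Or.inl (Set.mem_iUnion.2 ⟨i, Set.mem_iUnion.2 ⟨j, l, rfl⟩⟩)))
  let R : Subalgebra k B :=
    { carrier := {x | ∀ i, b.repr x i ∈ F}
      mul_mem' := by
        intro x y hx hy l
        rw [← b.sum_repr x, ← b.sum_repr y, Finset.sum_mul_sum]
        simp only [map_sum, Finsupp.coe_finsetSum, Finset.sum_apply, smul_mul_smul_comm, map_smul,
          Finsupp.smul_apply, smul_eq_mul]
        exact sum_mem fun i _ => sum_mem fun j _ =>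
          mul_mem (mul_mem (hx i) (hy j)) (hmul i j l)
      add_mem' := by
        intro x y hx hy l
        simpa using add_mem (hx l) (hy l)
      algebraMap_mem' := by
        intro a l
        rw [Algebra.algebraMap_eq_smul_one, ← algebraMap_smul k' a (1 : B), map_smul]
        exact mul_mem (F.algebraMap_mem a) (htF (Or.inl (Or.inr ⟨l, rfl⟩))) }
  refine ⟨R, inferInstance, inferInstance, ?_, R.val, Subtype.val_injective,
    fun x hx => ⟨⟨x, fun i => htF (Or.inr (Set.mem_biUnion hx ⟨i, rfl⟩))⟩, rfl⟩⟩
  let f : R →ₗ[k] (Fin (Module.finrank k' B) → F) :=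
    { toFun := fun x i => ⟨b.repr x i, x.2 i⟩
      map_add' := fun x y => by ext; simp
      map_smul' := fun a x => by
        ext i
        change b.repr (a • (x : B)) i = a • b.repr x i
        rw [← algebraMap_smul k' a (x : B), map_smul, Algebra.smul_def]
        rfl }
  refine Module.Finite.of_injective f fun x y h => ?_
  apply Subtype.ext
  apply b.repr.injective
  ext i
  exact congr(($h i : k'))

/-! ### Factoring maps into scalar extensions through dual coalgebras. -/

section Factor

variable {k k' C D : Type*} [Field k] [Field k'] [Algebra k k'] [AddCommGroup C] [Module k C]
  [Coalgebra k C] [AddCommGroup D] [Module k' D] [Coalgebra k' D]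

omit [Coalgebra k C] in
theorem exists_finite_extDual_eq_zero (z : k' ⊗[k] C) :
    ∃ W : Submodule k C, FiniteDimensional k W ∧
      ∀ f : C →ₗ[k] k, (∀ w ∈ W, f w = 0) → extDual k' f z = 0 := by
  induction z with
  | zero => exact ⟨⊥, inferInstance, by simp⟩
  | tmul a c =>
    refine ⟨Submodule.span k {c}, inferInstance, fun f hf => ?_⟩
    simp [hf c (Submodule.mem_span_singleton_self c)]
  | add x y hx hy =>
    obtain ⟨W, hW, hx⟩ := hx
    obtain ⟨W', hW', hy⟩ := hy
    refine ⟨W ⊔ W', inferInstance, fun f hf => ?_⟩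
    rw [map_add, hx f fun w hw => hf w (Submodule.mem_sup_left hw),
      hy f fun w hw => hf w (Submodule.mem_sup_right hw), add_zero]

/-- The images of a finite basis of `D` involve only finitely many vectors of `C`. -/
theorem isFinite_transpose [FiniteDimensional k' D] (φ : D →ₗc[k'] k' ⊗[k] C) :
    IsFinite (transpose φ) := by
  let b := Module.finBasis k' D
  choose W hW h using fun i => exists_finite_extDual_eq_zero (φ (b i))
  refine ⟨⨆ i, W i, inferInstance, fun f hf => ?_⟩
  refine WithConv.ext (b.ext fun i => ?_)
  exact h i _ fun w hw => hf w (Submodule.mem_iSup_of_mem i hw)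

theorem IsFinite.finiteDimensional_range {B : Type*} [Ring B] [Algebra k B]
    {θ : WithConv (C →ₗ[k] k) →ₐ[k] B} (hθ : IsFinite θ) : FiniteDimensional k θ.range := by
  obtain ⟨W, hW, h⟩ := hθ
  obtain ⟨p, hp⟩ := W.subtype.exists_leftInverse_of_injective W.ker_subtype
  let g : Module.Dual k W →ₗ[k] θ.range := θ.rangeRestrict.toLinearMap ∘ₗ
    (WithConv.linearEquiv k _).symm.toLinearMap ∘ₗ p.dualMap
  refine Module.Finite.of_surjective g ?_
  rintro ⟨_, f, rfl⟩
  refine ⟨f.ofConv ∘ₗ W.subtype, Subtype.ext ?_⟩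
  rw [← sub_eq_zero]
  change θ (toConv ((f.ofConv ∘ₗ W.subtype) ∘ₗ p)) - θ f = 0
  rw [← map_sub]
  refine h _ fun w hw => ?_
  have hpw : p w = ⟨w, hw⟩ := congr($hp ⟨w, hw⟩)
  simp [hpw]

theorem transpose_injective : Function.Injective (transpose (k := k) (k' := k') (C := C) (D := D)) :=
  fun _ _ h => CoalgHom.ext fun d => (separates_extDual (k := k)).eq fun f => congr($h (toConv f) d)

theorem transpose_map_comp {E : Type*} [AddCommGroup E] [Module k E] [Coalgebra k E]
    (ψ : E →ₗc[k] C) (φ : D →ₗc[k'] k' ⊗[k] E) (f : WithConv (C →ₗ[k] k)) :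
    transpose ((Coalgebra.TensorProduct.map (CoalgHom.id k' k') ψ).comp φ) f =
      transpose φ (toConv (f.ofConv ∘ₗ ψ.toLinearMap)) := by
  ext d
  simp only [transpose_apply, ← extDual_baseChange]
  rfl

variable {A : Type*} [Ring A] [Algebra k A] [FiniteDimensional k A]
  {j : A →ₐ[k] WithConv (D →ₗ[k'] k')}

/-- A coalgebra map `D → k' ⊗ C` whose transpose takes values in a finite-dimensional
`k`-subalgebra `A` factors through `D → k' ⊗ Aᵛ`. -/
theorem exists_factor_toDual (hj : Function.Injective j) (φ : D →ₗc[k'] k' ⊗[k] C)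
    (hφ : IsFinite (transpose φ)) (h : ∀ f, transpose φ f ∈ j.range) :
    ∃ ψ : Module.Dual k A →ₗc[k] C,
      (Coalgebra.TensorProduct.map (CoalgHom.id k' k') ψ).comp (toDual j) = φ := by
  let θ : WithConv (C →ₗ[k] k) →ₐ[k] A :=
    (AlgEquiv.ofInjective j hj).symm.toAlgHom.comp ((transpose φ).codRestrict j.range h)
  have hθ (f) : j (θ f) = transpose φ f :=
    congrArg Subtype.val ((AlgEquiv.ofInjective j hj).apply_symm_apply ⟨transpose φ f, h f⟩)
  obtain ⟨W, hW, hW'⟩ := hφ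
  obtain ⟨ψ, hψ⟩ := exists_fromDual θ
    ⟨W, hW, fun f hf => hj (by rw [hθ, hW' f hf, map_zero])⟩
  refine ⟨ψ, transpose_injective (AlgHom.ext fun f => ?_)⟩
  rw [transpose_map_comp, transpose_toDual', ← hθ]
  congr 1
  rw [AlgEquiv.symm_apply_eq]
  ext ρ
  exact hψ f ρ

/-- The transpose of each composite is `j` after the dual of `g` or `h`. Injectivity of `j` cancels
it, and functionals on `C` separate points. -/
theorem toDual_epi (hj : Function.Injective j) {g h : Module.Dual k A →ₗc[k] C}
    (H : (Coalgebra.TensorProduct.map (CoalgHom.id k' k') g).comp (toDual j) =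
      (Coalgebra.TensorProduct.map (CoalgHom.id k' k') h).comp (toDual j)) : g = h := by
  refine CoalgHom.ext fun ρ => (separates_all (k := k) (V := C)).eq fun f => ?_
  have := congr(transpose $H (toConv f))
  rw [transpose_map_comp, transpose_map_comp, transpose_toDual', transpose_toDual'] at this
  have := (evalAlgEquiv k A).symm.injective (hj this)
  exact congr($this ρ)

end Factor

/-- Over an algebraic extension, finitely many coalgebra maps from a finite-dimensional
`k'`-coalgebra into scalar extensions factor through the scalar extension of a `k`-coalgebra, by a
map that is epimorphic for maps over `k`. -/
theorem exists_common_factor {k k' : Type u} [Field k] [Field k'] [Algebra k k']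
    [Algebra.IsAlgebraic k k'] {D : Type u} [AddCommGroup D] [Module k' D] [Coalgebra k' D]
    [FiniteDimensional k' D] {J : Type*} [Finite J] (C : J → Type u) [∀ i, AddCommGroup (C i)]
    [∀ i, Module k (C i)] [∀ i, Coalgebra k (C i)] (φ : ∀ i, D →ₗc[k'] k' ⊗[k] C i) :
    ∃ (E : Type u) (_ : AddCommGroup E) (_ : Module k E) (_ : Coalgebra k E)
      (η : D →ₗc[k'] k' ⊗[k] E),
      (∀ i, ∃ ψ : E →ₗc[k] C i,
        (Coalgebra.TensorProduct.map (CoalgHom.id k' k') ψ).comp η = φ i) ∧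
      ∀ (X : Type u) [AddCommGroup X] [Module k X] [Coalgebra k X] (g h : E →ₗc[k] X),
        (Coalgebra.TensorProduct.map (CoalgHom.id k' k') g).comp η =
          (Coalgebra.TensorProduct.map (CoalgHom.id k' k') h).comp η → g = h := by
  have : FiniteDimensional k' (WithConv (D →ₗ[k'] k')) :=
    Module.Finite.equiv (WithConv.linearEquiv k' (D →ₗ[k'] k')).symm
  have : IsScalarTower k k' (WithConv (D →ₗ[k'] k')) :=
    ⟨fun a b x => WithConv.ext (smul_assoc a b x.ofConv)⟩
  have hfg (i) : (Subalgebra.toSubmodule (transpose (φ i)).range).FG :=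
    Module.Finite.iff_fg.1 (isFinite_transpose (φ i)).finiteDimensional_range
  choose s hs using hfg
  obtain ⟨A, _, _, _, j, hj, hsj⟩ := exists_subalgebra_finite (k := k) (k' := k')
    (Set.finite_iUnion fun i => (s i).finite_toSet)
  refine ⟨Module.Dual k A, inferInstance, inferInstance, inferInstance, toDual j, fun i => ?_,
    fun X _ _ _ g h => toDual_epi hj⟩
  refine exists_factor_toDual hj (φ i) (isFinite_transpose (φ i)) fun f => ?_
  have hle : Subalgebra.toSubmodule (transpose (φ i)).range ≤ Subalgebra.toSubmodule j.range := by
    rw [← hs i, Submodule.span_le]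
    exact (Set.subset_iUnion (fun i => (s i : Set (WithConv (D →ₗ[k'] k')))) i).trans hsj
  exact hle ⟨f, rfl⟩

/-! ### Local finiteness of coalgebras. -/

section Actions

variable {k C : Type*} [Field k] [AddCommGroup C] [Module k C] [Coalgebra k C]

/-- The action `c ↦ f(c₁) c₂` of the convolution algebra on a coalgebra. -/
noncomputable def actLeft (f : WithConv (C →ₗ[k] k)) : C →ₗ[k] C :=
  (TensorProduct.lid k C).toLinearMap ∘ₗ f.ofConv.rTensor C ∘ₗ comul

/-- The action `c ↦ f(c₂) c₁` of the convolution algebra on a coalgebra. -/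
noncomputable def actRight (f : WithConv (C →ₗ[k] k)) : C →ₗ[k] C :=
  (TensorProduct.rid k C).toLinearMap ∘ₗ f.ofConv.lTensor C ∘ₗ comul

theorem apply_actLeft (f g : WithConv (C →ₗ[k] k)) (c : C) : g (actLeft f c) = (f * g) c := by
  rw [convMul_apply_eq_pairing]
  simp only [actLeft, coe_comp, Function.comp_apply]
  generalize (comul c : C ⊗[k] C) = z
  induction z with
  | zero => simp
  | add x y hx hy => simp only [map_add, hx, hy]
  | tmul v w => simp

theorem apply_actRight (f g : WithConv (C →ₗ[k] k)) (c : C) : g (actRight f c) = (g * f) c := by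
  rw [convMul_apply_eq_pairing]
  simp only [actRight, coe_comp, Function.comp_apply]
  generalize (comul c : C ⊗[k] C) = z
  induction z with
  | zero => simp
  | add x y hx hy => simp only [map_add, hx, hy]
  | tmul v w => simp [mul_comm]

omit [Coalgebra k C] in
theorem conv_ext {c d : C} (h : ∀ g : WithConv (C →ₗ[k] k), g c = g d) : c = d :=
  (separates_all (k := k)).eq fun g => h (toConv g)

theorem actLeft_actLeft (f g : WithConv (C →ₗ[k] k)) (c : C) :
    actLeft g (actLeft f c) = actLeft (f * g) c :=
  conv_ext (k := k) fun h => by simp only [apply_actLeft, mul_assoc]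

theorem actRight_actRight (f g : WithConv (C →ₗ[k] k)) (c : C) :
    actRight g (actRight f c) = actRight (g * f) c :=
  conv_ext (k := k) fun h => by simp only [apply_actRight, mul_assoc]

theorem actRight_actLeft (f g : WithConv (C →ₗ[k] k)) (c : C) :
    actRight g (actLeft f c) = actLeft f (actRight g c) :=
  conv_ext (k := k) fun h => by simp only [apply_actRight, apply_actLeft, mul_assoc]

theorem actLeft_one (c : C) : actLeft (1 : WithConv (C →ₗ[k] k)) c = c :=
  conv_ext (k := k) fun h => by simp only [apply_actLeft, one_mul]

theorem actRight_one (c : C) : actRight (1 : WithConv (C →ₗ[k] k)) c = c :=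
  conv_ext (k := k) fun h => by simp only [apply_actRight, mul_one]

theorem exists_finite_actLeft_mem (c : C) :
    ∃ W : Submodule k C, FiniteDimensional k W ∧ ∀ f : WithConv (C →ₗ[k] k), actLeft f c ∈ W := by
  simp only [actLeft, coe_comp, Function.comp_apply]
  generalize (comul c : C ⊗[k] C) = z
  induction z with
  | zero => exact ⟨⊥, inferInstance, by simp⟩
  | tmul v w =>
    refine ⟨Submodule.span k {w}, inferInstance, fun f => ?_⟩
    simpa using Submodule.smul_mem _ _ (Submodule.mem_span_singleton_self w)
  | add x y hx hy =>
    obtain ⟨W, hW, hx⟩ := hx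
    obtain ⟨W', hW', hy⟩ := hy
    refine ⟨W ⊔ W', inferInstance, fun f => ?_⟩
    simp only [map_add]
    exact add_mem (Submodule.mem_sup_left (hx f)) (Submodule.mem_sup_right (hy f))

theorem exists_finite_actRight_mem (c : C) :
    ∃ W : Submodule k C, FiniteDimensional k W ∧ ∀ f : WithConv (C →ₗ[k] k), actRight f c ∈ W := by
  simp only [actRight, coe_comp, Function.comp_apply]
  generalize (comul c : C ⊗[k] C) = z
  induction z with
  | zero => exact ⟨⊥, inferInstance, by simp⟩
  | tmul v w =>
    refine ⟨Submodule.span k {v}, inferInstance, fun f => ?_⟩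
    simpa using Submodule.smul_mem _ _ (Submodule.mem_span_singleton_self v)
  | add x y hx hy =>
    obtain ⟨W, hW, hx⟩ := hx
    obtain ⟨W', hW', hy⟩ := hy
    refine ⟨W ⊔ W', inferInstance, fun f => ?_⟩
    simp only [map_add]
    exact add_mem (Submodule.mem_sup_left (hx f)) (Submodule.mem_sup_right (hy f))

/-- A subspace stable under both actions of the convolution algebra, i.e. a subcoalgebra. -/
def IsStable (W : Submodule k C) : Prop :=
  ∀ f : WithConv (C →ₗ[k] k), W ≤ W.comap (actLeft f) ∧ W ≤ W.comap (actRight f)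

theorem IsStable.iSup {ι : Sort*} {W : ι → Submodule k C} (h : ∀ i, IsStable (W i)) :
    IsStable (⨆ i, W i) := fun f =>
  ⟨iSup_le fun i => (h i f).1.trans (Submodule.comap_mono (le_iSup W i)),
    iSup_le fun i => (h i f).2.trans (Submodule.comap_mono (le_iSup W i))⟩

/-- The two-sided translates of `c` span a stable subspace. It is finite-dimensional because a
single comultiplication `Δ c` has finitely many legs, so each one-sided orbit is finite-dimensional.
-/
theorem exists_finite_isStable_mem (c : C) :
    ∃ W : Submodule k C, FiniteDimensional k W ∧ IsStable W ∧ c ∈ W := by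
  obtain ⟨M, hM, hcM⟩ := exists_finite_actRight_mem (k := k) c
  let N : Submodule k C := Submodule.span k (Set.range fun f : WithConv (C →ₗ[k] k) => actRight f c)
  have hNM : N ≤ M := Submodule.span_le.2 (by rintro _ ⟨f, rfl⟩; exact hcM f)
  have hN : FiniteDimensional k N := Submodule.finiteDimensional_of_le hNM
  obtain ⟨s, hs⟩ := Module.Finite.iff_fg.1 hN
  let W : Submodule k C := Submodule.span k
    (Set.range fun p : WithConv (C →ₗ[k] k) × WithConv (C →ₗ[k] k) => actLeft p.1 (actRight p.2 c))
  have hW (f : WithConv (C →ₗ[k] k)) (n) (hn : n ∈ N) : actLeft f n ∈ W := by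
    refine (Submodule.span_le (p := W.comap (actLeft f))).2 ?_ hn
    rintro _ ⟨g, rfl⟩
    exact Submodule.subset_span ⟨(f, g), rfl⟩
  refine ⟨W, ?_, fun f => ⟨Submodule.span_le.2 ?_, Submodule.span_le.2 ?_⟩, ?_⟩
  -- Left translates of all of `N` are controlled by those of its finitely many generators.
  · choose P hP hPs using fun n : s => exists_finite_actLeft_mem (k := k) (n : C)
    refine Submodule.finiteDimensional_of_le (S₂ := ⨆ n, P n) (Submodule.span_le.2 ?_)
    rintro _ ⟨⟨f, g⟩, rfl⟩
    have : N ≤ (⨆ n, P n).comap (actLeft f) := by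
      rw [← hs, Submodule.span_le]
      exact fun n hn => Submodule.mem_iSup_of_mem ⟨n, hn⟩ (hPs ⟨n, hn⟩ f)
    exact this (Submodule.subset_span ⟨g, rfl⟩)
  · rintro _ ⟨⟨g, h⟩, rfl⟩
    exact Submodule.subset_span ⟨(g * f, h), (actLeft_actLeft g f (actRight h c)).symm⟩
  · rintro _ ⟨⟨g, h⟩, rfl⟩
    refine Submodule.subset_span ⟨(g, f * h), ?_⟩
    simp only [actRight_actLeft, actRight_actRight]
  · refine Submodule.subset_span ⟨(1, 1), ?_⟩
    simp only [actLeft_one, actRight_one]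

variable {E : Type*} [AddCommGroup E] [Module k E]

theorem IsStable.map_map_comul {W : Submodule k C} (hW : IsStable W) {q : C →ₗ[k] C}
    (hq : ∀ w ∈ W, q w = w) {w : C} (hw : w ∈ W) : TensorProduct.map q q (comul w) = comul w := by
  -- Slicing `Δ w` by a functional on the second leg gives a right translate of `w`, which lies in
  -- `W` and is fixed by `q`; the other leg is symmetric.
  have h1 : q.rTensor C (comul w) = comul w := by
    rw [← sub_eq_zero]
    refine rid_lTensor_separates (separates_all (k := k)) _ fun f => ?_
    have : TensorProduct.rid k C (f.lTensor C (q.rTensor C (comul w))) =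
        q (actRight (toConv f) w) := by
      simp only [actRight, coe_comp, Function.comp_apply]
      generalize (comul w : C ⊗[k] C) = z
      induction z with
      | zero => simp
      | add x y hx hy => simp only [map_add, hx, hy]
      | tmul v w => simp
    rw [map_sub, map_sub, this, hq _ ((hW _).2 hw)]
    exact sub_self _
  have h2 : q.lTensor C (comul w) = comul w := by
    rw [← sub_eq_zero]
    refine lid_rTensor_separates (separates_all (k := k)) _ fun f => ?_
    have : TensorProduct.lid k C (f.rTensor C (q.lTensor C (comul w))) =
        q (actLeft (toConv f) w) := by
      simp only [actLeft, coe_comp, Function.comp_apply]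
      generalize (comul w : C ⊗[k] C) = z
      induction z with
      | zero => simp
      | add x y hx hy => simp only [map_add, hx, hy]
      | tmul v w => simp
    rw [map_sub, map_sub, this, hq _ ((hW _).1 hw)]
    exact sub_self _
  conv_rhs => rw [← h2, ← h1, ← LinearMap.comp_apply, lTensor_comp_rTensor]

theorem map_injective {V W : Type*} [AddCommGroup V] [Module k V] [AddCommGroup W] [Module k W]
    {V' W' : Type*} [AddCommGroup V'] [Module k V'] [AddCommGroup W'] [Module k W']
    {f : V →ₗ[k] V'} {g : W →ₗ[k] W'} (hf : Function.Injective f) (hg : Function.Injective g) :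
    Function.Injective (TensorProduct.map f g) :=
  TensorProduct.map_injective_of_flat_flat f g hf hg

/-- A coalgebra structure on a space embedded in a coalgebra. -/
@[reducible]
noncomputable def coalgebraOfInjective (i : E →ₗ[k] C) (hi : Function.Injective i)
    (δ : E →ₗ[k] E ⊗[k] E) (hδ : ∀ x, TensorProduct.map i i (δ x) = comul (i x)) :
    Coalgebra k E where
  comul := δ
  counit := counit ∘ₗ i
  coassoc := by
    have hδ' : TensorProduct.map i i ∘ₗ δ = comul ∘ₗ i := LinearMap.ext hδ
    ext x
    apply map_injective hi (map_injective hi hi)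
    have h := Coalgebra.coassoc_apply (R := k) (i x)
    have h1 (z : E ⊗[k] E) : TensorProduct.map i (TensorProduct.map i i)
        (TensorProduct.assoc k E E E (δ.rTensor E z)) =
        TensorProduct.assoc k C C C (comul.rTensor C (TensorProduct.map i i z)) := by
      rw [← LinearMap.comp_apply (rTensor C _), rTensor_comp_map, ← hδ',
        TensorProduct.map_map_assoc, ← LinearMap.comp_apply (TensorProduct.map _ _),
        map_comp_rTensor]
    have h2 (z : E ⊗[k] E) : TensorProduct.map i (TensorProduct.map i i) (δ.lTensor E z) =
        comul.lTensor C (TensorProduct.map i i z) := by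
      rw [← LinearMap.comp_apply (lTensor C _), lTensor_comp_map, ← hδ',
        ← LinearMap.comp_apply (TensorProduct.map _ _), map_comp_lTensor]
    simpa only [h1, h2, hδ, coe_comp, Function.comp_apply, LinearEquiv.coe_coe] using h
  rTensor_counit_comp_comul := by
    ext x
    apply map_injective (f := LinearMap.id) Function.injective_id hi
    have h := Coalgebra.rTensor_counit_comul (R := k) (i x)
    rw [← hδ, ← LinearMap.comp_apply (rTensor C _), rTensor_comp_map] at h
    rw [LinearMap.comp_apply, ← LinearMap.comp_apply (TensorProduct.map _ _), map_comp_rTensor]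
    exact h
  lTensor_counit_comp_comul := by
    ext x
    apply map_injective (g := LinearMap.id) hi Function.injective_id
    have h := Coalgebra.lTensor_counit_comul (R := k) (i x)
    rw [← hδ, ← LinearMap.comp_apply (lTensor C _), lTensor_comp_map] at h
    rw [LinearMap.comp_apply, ← LinearMap.comp_apply (TensorProduct.map _ _), map_comp_lTensor]
    exact h

theorem IsStable.exists_coalgebra {W : Submodule k C} (hW : IsStable W) :
    ∃ (_ : Coalgebra k W) (i : W →ₗc[k] C), ∀ w, i w = w := by
  obtain ⟨p, hp⟩ := W.subtype.exists_leftInverse_of_injective W.ker_subtype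
  have hi : Function.Injective W.subtype := Subtype.val_injective
  let δ : W →ₗ[k] W ⊗[k] W := TensorProduct.map p p ∘ₗ comul ∘ₗ W.subtype
  have hδ (w : W) : TensorProduct.map W.subtype W.subtype (δ w) = comul (w : C) := by
    simp only [δ, coe_comp, Function.comp_apply, ← LinearMap.comp_apply (TensorProduct.map _ _)
      (TensorProduct.map _ _), ← TensorProduct.map_comp]
    exact hW.map_map_comul (fun w hw => congrArg Subtype.val congr($hp ⟨w, hw⟩)) w.2
  let := coalgebraOfInjective W.subtype hi δ hδ
  exact ⟨inferInstance, ⟨W.subtype, rfl, LinearMap.ext hδ⟩, fun w => rfl⟩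

/-- Over a field, finitely many elements of a coalgebra lie in a finite-dimensional
subcoalgebra. -/
theorem exists_finite_subcoalgebra (k : Type*) {C : Type u} [Field k] [AddCommGroup C] [Module k C]
    [Coalgebra k C] {s : Set C} (hs : s.Finite) :
    ∃ (E : Type u) (_ : AddCommGroup E) (_ : Module k E) (_ : Coalgebra k E)
      (_ : FiniteDimensional k E) (i : E →ₗc[k] C), Function.Injective i ∧ s ⊆ Set.range i := by
  choose W hW hWs hcW using fun c : s => exists_finite_isStable_mem (k := k) (c : C)
  have := hs.to_subtype
  obtain ⟨_, i, hi⟩ := (IsStable.iSup hWs).exists_coalgebra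
  refine ⟨↥(⨆ c, W c), inferInstance, inferInstance, inferInstance, inferInstance, i,
    fun x y h => Subtype.ext (by rw [← hi, ← hi, h]), fun c hc => ?_⟩
  exact ⟨⟨c, Submodule.mem_iSup_of_mem ⟨c, hc⟩ (hcW ⟨c, hc⟩)⟩, hi _⟩

/-- A coalgebra map with values in the range of an injective one factors through it. -/
theorem exists_lift_of_injective {E F : Type*} [AddCommGroup E] [Module k E] [Coalgebra k E]
    [AddCommGroup F] [Module k F] [Coalgebra k F] {i : E →ₗc[k] C} (hi : Function.Injective i)
    (φ : F →ₗc[k] C) (h : ∀ x, φ x ∈ Set.range i) : ∃ ψ : F →ₗc[k] E, i.comp ψ = φ := by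
  let e := LinearEquiv.ofInjective i.toLinearMap hi
  let ψ : F →ₗ[k] E := e.symm.toLinearMap ∘ₗ
    φ.toLinearMap.codRestrict (LinearMap.range i.toLinearMap) h
  have hψ : i.toLinearMap ∘ₗ ψ = φ.toLinearMap := LinearMap.ext fun x =>
    congrArg Subtype.val (e.apply_symm_apply ⟨φ x, h x⟩)
  refine ⟨⟨ψ, ?_, ?_⟩, CoalgHom.ext fun x => congr($hψ x)⟩
  · rw [← i.counit_comp, LinearMap.comp_assoc, hψ, φ.counit_comp]
  · ext x
    apply map_injective hi hi
    have h1 := congr($(φ.map_comp_comul) x)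
    have h2 := congr($(i.map_comp_comul) (ψ x))
    rw [← hψ, TensorProduct.map_comp] at h1
    exact h1.trans h2.symm

end Actions

/-! ### Completeness of the category of coalgebras. -/

section Limits

variable (k : Type u) [Field k]

/-- Coalgebras are comonoids in modules, i.e. opposite to monoids in the opposite category, and
monoid objects inherit limits. -/
instance hasColimits_coalgCat : HasColimits (CoalgCat.{u} k) := by
  have : HasLimits (ModuleCat.{u} k)ᵒᵖ := hasLimits_op_of_hasColimits
  have : HasLimits (Mon (ModuleCat.{u} k)ᵒᵖ) := ⟨fun _ _ => inferInstance⟩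
  have : HasColimits (Mon (ModuleCat.{u} k)ᵒᵖ)ᵒᵖ := hasColimits_op_of_hasLimits
  have e := (CoalgCat.comonEquivalence k).trans (Comon.Comon_EquivMon_OpOp (ModuleCat.{u} k))
  exact Adjunction.has_colimits_of_equivalence e.functor

/-- The forgetful functor to modules as a composite of equivalences and the forgetful functor from
monoid objects. -/
noncomputable def forgetIso : forget₂ (CoalgCat.{u} k) (ModuleCat.{u} k) ≅
    (CoalgCat.comonEquivalence k).functor ⋙ (Comon.Comon_EquivMon_OpOp (ModuleCat.{u} k)).functor ⋙
      (Mon.forget (ModuleCat.{u} k)ᵒᵖ).op ⋙ (opOpEquivalence _).functor :=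
  NatIso.ofComponents fun _ => Iso.refl _

instance preservesColimits_forget : PreservesColimits (forget₂ (CoalgCat.{u} k) (ModuleCat.{u} k)) := by
  have : HasLimits (ModuleCat.{u} k)ᵒᵖ := hasLimits_op_of_hasColimits
  have : PreservesLimits (Mon.forget (ModuleCat.{u} k)ᵒᵖ) := ⟨inferInstance⟩
  have : PreservesColimits (Mon.forget (ModuleCat.{u} k)ᵒᵖ).op := preservesColimits_op _
  exact preservesColimits_of_natIso (forgetIso k).symm

variable {k}

theorem surjective_of_epi {X Y : CoalgCat.{u} k} (f : X ⟶ Y) [Epi f] :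
    Function.Surjective f.toCoalgHom :=
  (ModuleCat.epi_iff_surjective ((forget₂ (CoalgCat.{u} k) (ModuleCat.{u} k)).map f)).1
    inferInstance

theorem exists_factor_of_surjective {C D E : Type*} [AddCommGroup C] [Module k C] [Coalgebra k C]
    [AddCommGroup D] [Module k D] [Coalgebra k D] [AddCommGroup E] [Module k E] [Coalgebra k E]
    {f : C →ₗc[k] D} (hf : Function.Surjective f) (g : C →ₗc[k] E)
    (h : ker f.toLinearMap ≤ ker g.toLinearMap) : ∃ φ : D →ₗc[k] E, φ.comp f = g := by
  obtain ⟨s, hs⟩ := f.toLinearMap.exists_rightInverse_of_surjective (range_eq_top.2 hf)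
  let φ : D →ₗ[k] E := g.toLinearMap ∘ₗ s
  have hφ : φ ∘ₗ f.toLinearMap = g.toLinearMap := by
    ext x
    rw [← sub_eq_zero]
    change g.toLinearMap (s (f.toLinearMap x)) - g.toLinearMap x = 0
    rw [← map_sub, ← mem_ker]
    refine h ?_
    rw [mem_ker, map_sub, sub_eq_zero]
    exact congr($hs (f x))
  refine ⟨⟨φ, ?_, ?_⟩, CoalgHom.ext fun x => congr($hφ x)⟩
  · rw [← LinearMap.cancel_right (g := f.toLinearMap) hf, LinearMap.comp_assoc, hφ, g.counit_comp,
      f.counit_comp]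
  · rw [← LinearMap.cancel_right (g := f.toLinearMap) hf, LinearMap.comp_assoc, LinearMap.comp_assoc, hφ,
      ← f.map_comp_comul, ← LinearMap.comp_assoc, ← TensorProduct.map_comp, hφ, g.map_comp_comul]

/-- Epimorphisms are surjective because the forgetful functor preserves colimits, and a quotient
coalgebra is determined by its kernel. So quotients of `X` embed in the submodules of `X`. -/
instance wellPowered_op : WellPowered.{u} (CoalgCat.{u} k)ᵒᵖ where
  subobject_small := by
    rintro ⟨X⟩
    let F : Subobject (Opposite.op X) → Submodule k X := fun P =>
      ker P.arrow.unop.toCoalgHom.toLinearMap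
    have hle (P Q : Subobject (Opposite.op X)) (h : F Q ≤ F P) : P ≤ Q := by
      obtain ⟨φ, hφ⟩ := exists_factor_of_surjective (surjective_of_epi Q.arrow.unop)
        P.arrow.unop.toCoalgHom h
      let φ' : Opposite.unop (Q : (CoalgCat.{u} k)ᵒᵖ) ⟶ Opposite.unop (P : (CoalgCat.{u} k)ᵒᵖ) :=
        CoalgCat.Hom.mk φ
      refine Subobject.le_of_comm φ'.op ?_
      apply Quiver.Hom.unop_inj
      exact CoalgCat.hom_ext _ _ hφ
    exact small_of_injective (f := F) fun P Q h => le_antisymm (hle P Q h.ge) (hle Q P h.le)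

/-- The standard vector space of dimension `n`, as a type without coalgebra structure. -/
def StdSpace (k : Type u) (n : ℕ) : Type u := Fin n → k

instance (n : ℕ) : AddCommGroup (StdSpace k n) := inferInstanceAs (AddCommGroup (Fin n → k))

instance (n : ℕ) : Module k (StdSpace k n) := inferInstanceAs (Module k (Fin n → k))

/-- The coalgebras with underlying space `kⁿ`. -/
noncomputable def stdCoalg (k : Type u) [Field k] (p : Σ n : ℕ, Coalgebra k (StdSpace k n)) :
    CoalgCat.{u} k :=
  letI := p.2
  CoalgCat.of k (StdSpace k p.1)

theorem exists_stdCoalg_hom (E : Type*) [AddCommGroup E] [Module k E] [Coalgebra k E]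
    [FiniteDimensional k E] : ∃ p, ∃ e : stdCoalg k p →ₗc[k] E, Function.Surjective e := by
  let e : StdSpace k _ ≃ₗ[k] E := (Module.finBasis k E).equivFun.symm
  have h (x) : TensorProduct.map e.toLinearMap e.toLinearMap
      ((TensorProduct.map e.symm.toLinearMap e.symm.toLinearMap ∘ₗ comul ∘ₗ e.toLinearMap) x) =
      comul (e.toLinearMap x) := by
    rw [LinearMap.comp_apply, ← LinearMap.comp_apply (TensorProduct.map _ _),
      ← TensorProduct.map_comp]
    simp
  let c := coalgebraOfInjective e.toLinearMap e.injective
    (TensorProduct.map e.symm.toLinearMap e.symm.toLinearMap ∘ₗ comul ∘ₗ e.toLinearMap) h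
  exact ⟨⟨_, c⟩, ⟨e.toLinearMap, rfl, LinearMap.ext h⟩, e.surjective⟩

theorem isSeparating_stdCoalg : (ObjectProperty.ofObj (stdCoalg k)).IsSeparating := by
  intro X Y f g h
  refine CoalgCat.hom_ext _ _ (CoalgHom.ext fun x => ?_)
  obtain ⟨E, _, _, _, _, i, hi, hx⟩ := exists_finite_subcoalgebra k (Set.finite_singleton x)
  obtain ⟨y, hy⟩ := hx rfl
  obtain ⟨p, e, he⟩ := exists_stdCoalg_hom (k := k) E
  obtain ⟨z, rfl⟩ := he y
  let e' : stdCoalg k p ⟶ X := CoalgCat.Hom.mk (i.comp e)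
  rw [← hy]
  exact congr(CoalgCat.Hom.toCoalgHom $(h _ (ObjectProperty.ofObj_apply _ p) e') z)

/-- Special adjoint functor theorem: cocomplete, co-well-powered, and separated by the small family
of coalgebras on the spaces `kⁿ`. -/
instance hasLimits_coalgCat : HasLimits (CoalgCat.{u} k) :=
  hasLimits_of_hasColimits_of_isSeparating isSeparating_stdCoalg

end Limits

/-! ### Algebraic extensions preserve finite limits of coalgebras. -/

section FiniteLimits

variable {k k' : Type u} [Field k] [Field k'] [Algebra k k'] [Algebra.IsAlgebraic k k']

theorem exists_common_factor_coalgCat {D : CoalgCat.{u} k'} [FiniteDimensional k' D] {J : Type*}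
    [Finite J] (C : J → CoalgCat.{u} k) (φ : ∀ j, D ⟶ (coalg k k').obj (C j)) :
    ∃ (E : CoalgCat.{u} k) (η : D ⟶ (coalg k k').obj E),
      (∀ j, ∃ ψ : E ⟶ C j, η ≫ (coalg k k').map ψ = φ j) ∧
      ∀ (X : CoalgCat.{u} k) (g h : E ⟶ X),
        η ≫ (coalg k k').map g = η ≫ (coalg k k').map h → g = h := by
  obtain ⟨E, _, _, _, η, hη, hepi⟩ := exists_common_factor (k := k) (k' := k')
    (fun j => (C j : Type u)) (fun j => (φ j).toCoalgHom)
  refine ⟨CoalgCat.of k E, CoalgCat.Hom.mk η, fun j => ?_, fun X g h H => ?_⟩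
  · obtain ⟨ψ, hψ⟩ := hη j
    exact ⟨CoalgCat.Hom.mk ψ, CoalgCat.hom_ext _ _ hψ⟩
  · exact CoalgCat.hom_ext _ _ (hepi X _ _ (congrArg CoalgCat.Hom.toCoalgHom H))

variable {J : Type} [SmallCategory J] [FinCategory J] {K : J ⥤ CoalgCat.{u} k} {c : Cone K}

-- The pair `u`, `v` is a family indexed by `Bool`, so both maps descend along a common `η` to maps
-- into `c.pt` over `k`, where the universal property applies.
omit [FinCategory J] in
theorem hom_ext_of_finite (hc : IsLimit c) {D : CoalgCat.{u} k'} [FiniteDimensional k' D]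
    (u v : D ⟶ (coalg k k').obj c.pt)
    (h : ∀ j, u ≫ (coalg k k').map (c.π.app j) = v ≫ (coalg k k').map (c.π.app j)) : u = v := by
  obtain ⟨E, η, hη, hepi⟩ := exists_common_factor_coalgCat (k := k) (k' := k')
    (fun _ : Bool => c.pt) (fun b => bif b then u else v)
  obtain ⟨g, hg⟩ := hη true
  obtain ⟨g', hg'⟩ := hη false
  simp only [cond_true, cond_false] at hg hg'
  rw [← hg, ← hg']
  congr 2
  refine hc.hom_ext fun j => hepi _ _ _ ?_
  rw [Functor.map_comp, Functor.map_comp, ← Category.assoc, ← Category.assoc, hg, hg', h]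

/-- Finiteness of `J` lets all legs of the cone descend along one `η`; the cancellation property of
`η` makes the descended legs a cone over `k`. -/
theorem exists_lift_of_finite (hc : IsLimit c) (s : Cone (K ⋙ coalg k k'))
    [FiniteDimensional k' s.pt] :
    ∃ u : s.pt ⟶ (coalg k k').obj c.pt, ∀ j, u ≫ (coalg k k').map (c.π.app j) = s.π.app j := by
  obtain ⟨E, η, hη, hepi⟩ := exists_common_factor_coalgCat (k := k) (k' := k') K.obj s.π.app
  choose ψ hψ using hη
  let t : Cone K :=
    { pt := E
      π :=
        { app := ψ
          naturality := fun i j f => by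
            refine hepi _ _ _ ?_
            simp only [Functor.const_obj_obj, Functor.const_obj_map, Category.id_comp,
              Functor.map_comp]
            rw [← Category.assoc, hψ, hψ]
            exact (s.w f).symm } }
  refine ⟨η ≫ (coalg k k').map (hc.lift t), fun j => ?_⟩
  rw [Category.assoc, ← Functor.map_comp, hc.fac, hψ]

theorem preservesLimit_of_isAlgebraic (K : J ⥤ CoalgCat.{u} k) : PreservesLimit K (coalg k k') where
  preserves {c} hc := by
    let d := limit.cone (K ⋙ coalg k k')
    have hd : IsLimit d := limit.isLimit _
    let κ : (coalg k k').obj c.pt ⟶ d.pt := hd.lift ((coalg k k').mapCone c)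
    have hκ (j) : κ ≫ d.π.app j = (coalg k k').map (c.π.app j) := hd.fac _ j
    have hinj : Function.Injective κ.toCoalgHom := by
      rw [← CoalgHom.coe_toLinearMap, injective_iff_map_eq_zero]
      intro x hx
      obtain ⟨E, _, _, _, _, i, hi, hxi⟩ := exists_finite_subcoalgebra k' (Set.finite_singleton x)
      obtain ⟨y, rfl⟩ := hxi rfl
      let b := Module.finBasis k' E
      -- The kernel of `κ` need not be a subcoalgebra, so uniqueness cannot be applied to it.
      -- Instead the image of `E` is enclosed in a finite-dimensional `E'`, whose lift `σ` recovers
      -- the inclusion of `E`.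
      obtain ⟨E', _, _, _, _, i', hi', hb⟩ := exists_finite_subcoalgebra k'
        (Set.finite_range fun n => κ.toCoalgHom (i (b n)))
      obtain ⟨φ, hφ⟩ := exists_lift_of_injective hi' (κ.toCoalgHom.comp i) fun z => by
        have : LinearMap.range (κ.toCoalgHom.comp i).toLinearMap ≤
            LinearMap.range i'.toLinearMap := by
          rw [← Submodule.map_top, ← b.span_eq, Submodule.map_span_le]
          rintro _ ⟨n, rfl⟩
          exact hb ⟨n, rfl⟩
        exact this ⟨z, rfl⟩
      let ι : CoalgCat.of k' E ⟶ (coalg k k').obj c.pt := CoalgCat.Hom.mk i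
      let ι' : CoalgCat.of k' E' ⟶ d.pt := CoalgCat.Hom.mk i'
      let φ' : CoalgCat.of k' E ⟶ CoalgCat.of k' E' := CoalgCat.Hom.mk φ
      have hφ' : φ' ≫ ι' = ι ≫ κ := CoalgCat.hom_ext _ _ hφ
      have : FiniteDimensional k' (d.extend ι').pt := inferInstanceAs (FiniteDimensional k' E')
      obtain ⟨σ, hσ⟩ := exists_lift_of_finite hc (d.extend ι')
      have hσ' : φ' ≫ σ = ι := by
        have : FiniteDimensional k' (CoalgCat.of k' E) := inferInstanceAs (FiniteDimensional k' E)
        refine hom_ext_of_finite hc _ _ fun j => ?_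
        rw [Category.assoc, hσ, ← hκ, ← Category.assoc ι, ← hφ', Category.assoc]
        rfl
      have hy : φ y = 0 := hi' (by
        rw [← CoalgHom.comp_apply, hφ]
        exact hx.trans (map_zero i').symm)
      have := congr(CoalgCat.Hom.toCoalgHom $hσ' y)
      refine this.symm.trans ?_
      change σ.toCoalgHom (φ y) = 0
      rw [hy, map_zero]
    have hsurj : Function.Surjective κ.toCoalgHom := by
      intro x
      obtain ⟨E, _, _, _, _, i, hi, hxi⟩ := exists_finite_subcoalgebra k' (Set.finite_singleton x)
      obtain ⟨y, rfl⟩ := hxi rfl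
      let ι : CoalgCat.of k' E ⟶ d.pt := CoalgCat.Hom.mk i
      have : FiniteDimensional k' (d.extend ι).pt := inferInstanceAs (FiniteDimensional k' E)
      obtain ⟨σ, hσ⟩ := exists_lift_of_finite hc (d.extend ι)
      have hσ' : σ ≫ κ = ι := hd.hom_ext fun j => by
        rw [Category.assoc, hκ, hσ]
        rfl
      exact ⟨σ.toCoalgHom y, congr(CoalgCat.Hom.toCoalgHom $hσ' y)⟩
    have : IsIso ((forget (CoalgCat.{u} k')).map κ) :=
      (isIso_iff_bijective _).2 ⟨hinj, hsurj⟩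
    have : IsIso κ := isIso_of_reflects_iso κ (forget _)
    exact ⟨IsLimit.ofPointIso hd (i := this)⟩

theorem preservesFiniteLimits_coalg (k k' : Type u) [Field k] [Field k'] [Algebra k k']
    [Algebra.IsAlgebraic k k'] : PreservesFiniteLimits (coalg k k') where
  preservesFiniteLimits _ _ _ := ⟨fun {K} => preservesLimit_of_isAlgebraic K⟩

end FiniteLimits

/-! ### Traces and pairs of representations. -/

section Transcendental

/-- Over an algebraic closure the trace is a sum of eigenvalues, and each eigenvalue is a root of
the monic polynomial over `k` that kills `T`. -/
theorem isIntegral_trace {k k' V : Type*} [Field k] [Field k'] [Algebra k k'] [AddCommGroup V]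
    [Module k V] [Module k' V] [IsScalarTower k k' V] [FiniteDimensional k' V]
    {T : Module.End k' V} (hT : IsIntegral k T) : IsIntegral k (LinearMap.trace k' V T) := by
  let K := AlgebraicClosure k'
  obtain ⟨p, hp, hpT⟩ := hT
  have hinj := (algebraMap k' K).injective
  rw [← isIntegral_algebraMap_iff hinj, ← LinearMap.trace_baseChange,
    Module.End.trace_eq_sum_roots_charpoly_of_splits (IsAlgClosed.splits _)]
  refine IsIntegral.multiset_sum fun μ hμ => ⟨p, hp, ?_⟩
  let T' : Module.End K (K ⊗[k'] V) := Module.End.baseChangeHom k' K V T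
  have hμ' : T'.HasEigenvalue μ :=
    (Module.End.hasEigenvalue_iff_isRoot_charpoly _ _).2 (Polynomial.isRoot_of_mem_roots hμ)
  obtain ⟨v, hv⟩ := hμ'.exists_hasEigenvector
  have hq : Polynomial.aeval T (p.map (algebraMap k k')) = 0 := by
    rw [Polynomial.aeval_map_algebraMap]
    exact hpT
  have h0 : Polynomial.aeval T' ((p.map (algebraMap k k')).map (algebraMap k' K)) = 0 := by
    rw [Polynomial.aeval_map_algebraMap, Polynomial.aeval_algHom_apply, hq, map_zero]
  have := Module.End.aeval_apply_of_hasEigenvector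
    (p := (p.map (algebraMap k k')).map (algebraMap k' K)) hv
  rw [h0, LinearMap.zero_apply] at this
  have := (smul_eq_zero.1 this.symm).resolve_right hv.2
  rwa [Polynomial.map_map, ← IsScalarTower.algebraMap_eq, Polynomial.eval_map] at this

/-- Conjugating by a transvection changes the trace of `x * x` quadratically. -/
theorem exists_conj_trace {K V : Type*} [Field K] [AddCommGroup V] [Module K V]
    [FiniteDimensional K V] (x : Module.End K V) (v : V) (φ : Module.Dual K V) (hv : φ v = 0)
    (hx : φ (x v) = 1) (t : K) : ∃ g : (Module.End K V)ˣ,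
      LinearMap.trace K V (x * (g * x * (g⁻¹ : (Module.End K V)ˣ))) =
        LinearMap.trace K V (x * x) - t ^ 2 := by
  -- A square-zero operator of rank one. In the expansion below, the term linear in `t` has trace
  -- zero by cyclicity, and the quadratic term contributes the trace of `x * N`, namely `φ (x v) =
  -- 1`.
  let N : Module.End K V := φ.smulRight v
  have hN : N * N = 0 := by ext; simp [N, hv]
  have hNxN : N * x * N = N := by ext; simp [N, hx]
  have hxN : LinearMap.trace K V (x * N) = 1 := by
    have : x * N = φ.smulRight (x v) := LinearMap.ext fun y => by simp [N]
    rw [this, LinearMap.trace_smulRight, hx]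
  have hunit (s : K) : (1 + s • N) * (1 - s • N) = 1 := by
    simp [mul_sub, add_mul, hN]
  let g : (Module.End K V)ˣ := ⟨1 + t • N, 1 - t • N, hunit t, by
    simpa [sub_eq_add_neg] using hunit (-t)⟩
  refine ⟨g, ?_⟩
  have : x * (g * x * (g⁻¹ : (Module.End K V)ˣ)) =
      x * x + t • (x * N * x - x * x * N) - t ^ 2 • (x * (N * x * N)) := by
    change x * ((1 + t • N) * x * (1 - t • N)) = _
    simp only [mul_sub, mul_add, add_mul, one_mul, mul_one, smul_mul_assoc, mul_smul_comm,
      pow_two, mul_assoc]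
    module
  rw [this, hNxN, map_sub, map_add, map_smul, map_smul, map_sub, hxN,
    LinearMap.trace_mul_comm K (x * N) x, ← mul_assoc, sub_self, smul_zero, add_zero, smul_eq_mul,
    mul_one]

/-- A nontrivial finite-dimensional algebra has two representations over `k'`, with the product of
two images integral over `k` only if a given element of `k'` is algebraic. -/
theorem exists_two_representations {k k' A : Type u} [Field k] [Field k'] [Algebra k k'] [Ring A]
    [Algebra k A] [FiniteDimensional k A] (hA : 1 < Module.finrank k A) (t : k') :
    ∃ (B : Type u) (_ : Ring B) (_ : Algebra k' B) (_ : Algebra k B) (_ : IsScalarTower k k' B)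
      (_ : FiniteDimensional k' B) (θ θ' : A →ₐ[k] B) (a : A),
      IsIntegral k (θ a * θ' a) → IsAlgebraic k t := by
  -- A non-scalar `a` provides a functional `f` vanishing at `1` but not at `a`; its extension is
  -- the functional needed for the transvection, as `θ a` sends `1 ⊗ 1` to `1 ⊗ a`.
  obtain ⟨a, ha⟩ : ∃ a : A, a ∉ Submodule.span k {(1 : A)} := by
    by_contra! H
    have := finrank_le_one (1 : A) fun a => Submodule.mem_span_singleton.1 (H a)
    omega
  obtain ⟨f, hf, hfa⟩ : ∃ f : Module.Dual k A, f 1 = 0 ∧ f a = 1 := by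
    obtain ⟨f, hf, hf'⟩ := Submodule.exists_le_ker_of_notMem ha
    refine ⟨(f a)⁻¹ • f, ?_, inv_mul_cancel₀ hf⟩
    have : f 1 = 0 := hf' (Submodule.mem_span_singleton_self 1)
    simp [this]
  let θ : A →ₐ[k] Module.End k' (k' ⊗[k] A) :=
    (Module.End.baseChangeHom k k' A).comp (Algebra.lmul k A)
  have hθ : θ a (1 ⊗ₜ 1) = 1 ⊗ₜ a := by
    change (1 : k') ⊗ₜ[k] (a * 1) = _
    rw [mul_one]
  obtain ⟨g, hg⟩ := exists_conj_trace (θ a) (1 ⊗ₜ 1) (extDual k' f) (by simp [hf])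
    (by rw [hθ]; simp [hfa]) t
  refine ⟨Module.End k' (k' ⊗[k] A), inferInstance, inferInstance, inferInstance, inferInstance,
    inferInstance, θ, (MulSemiringAction.toAlgHom k _ (ConjAct.toConjAct g)).comp θ, a,
    fun h => ?_⟩
  have h1 := isIntegral_trace h
  -- This trace is that of an endomorphism of `A` over `k`, so it comes from `k`; subtracting leaves
  -- `t ^ 2`.
  have h2 : IsIntegral k (LinearMap.trace k' (k' ⊗[k] A) (θ a * θ a)) := by
    rw [← map_mul]
    change IsIntegral k (LinearMap.trace k' (k' ⊗[k] A) ((Algebra.lmul k A (a * a)).baseChange k'))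
    rw [LinearMap.trace_baseChange]
    exact isIntegral_algebraMap
  have h3 : LinearMap.trace k' (k' ⊗[k] A)
      (θ a * (MulSemiringAction.toAlgHom k _ (ConjAct.toConjAct g)).comp θ a) = _ := hg
  rw [h3] at h1
  have h4 := h2.sub h1
  rw [sub_sub_cancel] at h4
  exact (h4.of_pow two_pos).isAlgebraic

end Transcendental

/-! ### A preserved square forces the extension to be algebraic. -/

section Existence

variable {k k' : Type u} [Field k] [Field k'] [Algebra k k']

/-- For finite-dimensional `C` the identity of `C*` is itself finite, so it yields a map `(C*)ᵛ → C`
with which `toDual j` can be composed. -/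
theorem exists_coalgHom_of_algHom {C D : Type*} [AddCommGroup C] [Module k C] [Coalgebra k C]
    [FiniteDimensional k C] [AddCommGroup D] [Module k' D] [Coalgebra k' D]
    (j : WithConv (C →ₗ[k] k) →ₐ[k] WithConv (D →ₗ[k'] k')) :
    ∃ φ : D →ₗc[k'] k' ⊗[k] C, transpose φ = j := by
  have : FiniteDimensional k (WithConv (C →ₗ[k] k)) :=
    Module.Finite.equiv (WithConv.linearEquiv k (C →ₗ[k] k)).symm
  obtain ⟨ψ, hψ⟩ := exists_fromDual (AlgHom.id k (WithConv (C →ₗ[k] k)))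
    ⟨⊤, inferInstance, fun f hf => WithConv.ext (LinearMap.ext fun x => hf x trivial)⟩
  refine ⟨(Coalgebra.TensorProduct.map (CoalgHom.id k' k') ψ).comp (toDual j),
    AlgHom.ext fun f => ?_⟩
  rw [transpose_map_comp, transpose_toDual']
  congr 1
  rw [AlgEquiv.symm_apply_eq]
  ext ρ
  exact hψ f ρ

/-- If the square of a finite-dimensional coalgebra of dimension greater than one is preserved by
scalar extension, then the extension is algebraic. -/
theorem isAlgebraic_of_preservesBinaryPower (C : CoalgCat.{u} k) [FiniteDimensional k C]
    (hC : 1 < Module.finrank k C) (h : PreservesBinaryPower (coalg k k') C) :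
    Algebra.IsAlgebraic k k' := by
  refine ⟨fun t => ?_⟩
  let A := WithConv (C →ₗ[k] k)
  have : FiniteDimensional k A := Module.Finite.equiv (WithConv.linearEquiv k (C →ₗ[k] k)).symm
  have hA : 1 < Module.finrank k A := by
    rwa [LinearEquiv.finrank_eq (WithConv.linearEquiv k (C →ₗ[k] k)), Subspace.dual_finrank_eq]
  obtain ⟨B, _, _, _, _, _, θ, θ', a, hint⟩ := exists_two_representations hA t
  have : IsScalarTower k k' (WithConv (Module.Dual k' B →ₗ[k'] k')) :=
    ⟨fun a b x => WithConv.ext (smul_assoc a b x.ofConv)⟩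
  let e : B ≃ₐ[k] WithConv (Module.Dual k' B →ₗ[k'] k') := (evalAlgEquiv k' B).restrictScalars k
  obtain ⟨φ, hφ⟩ := exists_coalgHom_of_algHom (e.toAlgHom.comp θ)
  obtain ⟨φ', hφ'⟩ := exists_coalgHom_of_algHom (e.toAlgHom.comp θ')
  let c := limit.cone (pair C C)
  have hL : IsLimit ((coalg k k').mapCone c) :=
    have : PreservesLimit (pair C C) (coalg k k') := h
    isLimitOfPreserves (coalg k k') (limit.isLimit (pair C C))
  let s : Cone (pair C C ⋙ coalg k k') :=
    { pt := CoalgCat.of k' (Module.Dual k' B)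
      π :=
        { app := fun j => match j with
            | ⟨WalkingPair.left⟩ => CoalgCat.Hom.mk φ
            | ⟨WalkingPair.right⟩ => CoalgCat.Hom.mk φ'
          naturality := by
            rintro ⟨_ | _⟩ ⟨_ | _⟩ ⟨⟨⟨⟩⟩⟩ <;> simp } }
  let Φ : Module.Dual k' B →ₗc[k'] k' ⊗[k] c.pt := (hL.lift s).toCoalgHom
  let p : c.pt →ₗc[k] C := (c.π.app ⟨WalkingPair.left⟩).toCoalgHom
  let p' : c.pt →ₗc[k] C := (c.π.app ⟨WalkingPair.right⟩).toCoalgHom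
  have hp : (Coalgebra.TensorProduct.map (CoalgHom.id k' k') p).comp Φ = φ :=
    congrArg CoalgCat.Hom.toCoalgHom (hL.fac s ⟨WalkingPair.left⟩)
  have hp' : (Coalgebra.TensorProduct.map (CoalgHom.id k' k') p').comp Φ = φ' :=
    congrArg CoalgCat.Hom.toCoalgHom (hL.fac s ⟨WalkingPair.right⟩)
  have h1 : e (θ a) = transpose Φ (toConv (a.ofConv ∘ₗ p.toLinearMap)) := by
    rw [← transpose_map_comp, hp, hφ]
    rfl
  have h2 : e (θ' a) = transpose Φ (toConv (a.ofConv ∘ₗ p'.toLinearMap)) := by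
    rw [← transpose_map_comp, hp', hφ']
    rfl
  apply hint
  rw [← isIntegral_algEquiv e, map_mul, h1, h2, ← map_mul]
  -- Both factors are values of the one algebra map `transpose Φ`, whose range is finite-dimensional
  -- over `k`.
  have := (isFinite_transpose Φ).finiteDimensional_range
  exact (Algebra.IsIntegral.isIntegral (R := k) ((transpose Φ).rangeRestrict _)).map
    (transpose Φ).range.val

end Existence

end ScalarExt

namespace ScalarExt

/-! ### Bialgebras as monoid objects of coalgebras. -/

section BialgMon

universe w

open MonoidalCategory MonObj

variable (k : Type u) [Field k]

/-- The monoid object of coalgebras underlying a bialgebra. -/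
noncomputable def monOfBialg (B : BialgCat.{u} k) : Mon (CoalgCat.{u} k) where
  X := CoalgCat.of k B
  mon :=
    { one := CoalgCat.ofHom (Bialgebra.unitBialgHom k B : k →ₗc[k] B)
      mul := CoalgCat.ofHom (Bialgebra.mulCoalgHom k B)
      one_mul := by
        apply CoalgCat.hom_ext
        apply CoalgHom.coe_linearMap_injective
        refine TensorProduct.ext' fun a b => ?_
        exact (Algebra.smul_def a b).symm
      mul_one := by
        apply CoalgCat.hom_ext
        apply CoalgHom.coe_linearMap_injective
        refine TensorProduct.ext' fun a b => ?_
        exact (Algebra.commutes b a).symm.trans (Algebra.smul_def b a).symm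
      mul_assoc := by
        apply CoalgCat.hom_ext
        apply CoalgHom.coe_linearMap_injective
        refine TensorProduct.ext_threefold fun a b c => ?_
        exact mul_assoc a b c }

/-- Bialgebras are monoid objects in the monoidal category of coalgebras. -/
noncomputable def bialgToMon : BialgCat.{u} k ⥤ Mon (CoalgCat.{u} k) where
  obj := monOfBialg k
  map {A B} f := Mon.Hom.mk' (M := monOfBialg k A) (N := monOfBialg k B)
    (CoalgCat.ofHom (f.toBialgHom : A →ₗc[k] B))
    (by
      apply CoalgCat.hom_ext
      apply CoalgHom.coe_linearMap_injective
      ext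
      exact f.toBialgHom.toAlgHom.commutes 1)
    (by
      apply CoalgCat.hom_ext
      apply CoalgHom.coe_linearMap_injective
      refine TensorProduct.ext' fun a b => ?_
      exact map_mul f.toBialgHom (show A from a) (show A from b))
  map_id _ := rfl
  map_comp _ _ := rfl

instance : (bialgToMon k).Faithful where
  map_injective {A B} f g h := by
    apply BialgCat.hom_ext
    refine DFunLike.ext _ _ fun x => ?_
    have h' : (bialgToMon k).map f = (bialgToMon k).map g := h
    exact CoalgHom.congr_fun (congrArg (fun t => CoalgCat.Hom.toCoalgHom (Mon.Hom.hom t)) h') x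

instance : (bialgToMon k).Full where
  map_surjective {A B} f := by
    let φ : A →ₗc[k] B := (Mon.Hom.hom f).toCoalgHom
    have h1 : φ 1 = 1 := by
      have := DFunLike.congr_fun (congrArg CoalgCat.Hom.toCoalgHom (IsMonHom.one_hom f.hom))
        (1 : k)
      exact ((congrArg φ (map_one (algebraMap k A))).symm.trans this).trans
        (map_one (algebraMap k B))
    have h2 : ∀ a b, φ (a * b) = φ a * φ b := fun a b =>
      DFunLike.congr_fun (congrArg CoalgCat.Hom.toCoalgHom (IsMonHom.mul_hom f.hom)) (a ⊗ₜ[k] b)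
    exact ⟨BialgCat.ofHom (BialgHom.ofAlgHom (AlgHom.ofLinearMap φ.toLinearMap h1 h2)
      (AlgHom.toLinearMap_injective φ.counit_comp)
      (AlgHom.toLinearMap_injective φ.map_comp_comul)), rfl⟩

variable {k}

/-- This turns the compatibility of a multiplication with comultiplications into multiplicativity of
the comultiplication. -/
theorem map_tensorTensorTensorComm_eq_mul {A : Type*} [Ring A] [Algebra k A]
    {m : A ⊗[k] A →ₗ[k] A} (hm : ∀ a b, m (a ⊗ₜ b) = a * b) (x y : A ⊗[k] A) :
    TensorProduct.map m m
      (TensorProduct.AlgebraTensorModule.tensorTensorTensorComm k k k k A A A A (x ⊗ₜ y)) =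
      x * y := by
  obtain rfl : m = LinearMap.mul' k A := TensorProduct.ext' hm
  rw [← LinearMap.mul'_apply (R := k), LinearMap.mul'_tensor]
  rfl

/-- The multiplication of a monoid object of coalgebras, as a coalgebra homomorphism. -/
noncomputable def monMul (M : Mon (CoalgCat.{u} k)) : M.X ⊗[k] M.X →ₗc[k] M.X :=
  CoalgCat.Hom.toCoalgHom μ[M.X]

/-- The unit of a monoid object of coalgebras, as a coalgebra homomorphism. -/
noncomputable def monOne (M : Mon (CoalgCat.{u} k)) : k →ₗc[k] M.X :=
  CoalgCat.Hom.toCoalgHom η[M.X]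

theorem monMul_assoc (M : Mon (CoalgCat.{u} k)) (a b c : M.X) :
    monMul M (monMul M (a ⊗ₜ b) ⊗ₜ c) = monMul M (a ⊗ₜ monMul M (b ⊗ₜ c)) :=
  DFunLike.congr_fun (congrArg CoalgCat.Hom.toCoalgHom (MonObj.mul_assoc M.X))
    ((a ⊗ₜ[k] b) ⊗ₜ[k] c)

theorem monOne_mul (M : Mon (CoalgCat.{u} k)) (r : k) (a : M.X) :
    monMul M (monOne M r ⊗ₜ a) = r • a :=
  DFunLike.congr_fun (congrArg CoalgCat.Hom.toCoalgHom (MonObj.one_mul M.X)) (r ⊗ₜ[k] a)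

theorem monMul_one (M : Mon (CoalgCat.{u} k)) (r : k) (a : M.X) :
    monMul M (a ⊗ₜ monOne M r) = r • a :=
  DFunLike.congr_fun (congrArg CoalgCat.Hom.toCoalgHom (MonObj.mul_one M.X)) (a ⊗ₜ[k] r)

/-- The ring structure of a monoid object of coalgebras. -/
@[reducible]
noncomputable def monRing (M : Mon (CoalgCat.{u} k)) : Ring M.X :=
  { (inferInstance : AddCommGroup M.X) with
    mul := fun a b => monMul M (a ⊗ₜ b)
    one := monOne M 1
    left_distrib := fun a b c => (congrArg (monMul M) (TensorProduct.tmul_add a b c)).trans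
      (map_add _ _ _)
    right_distrib := fun a b c => (congrArg (monMul M) (TensorProduct.add_tmul a b c)).trans
      (map_add _ _ _)
    zero_mul := fun a => (congrArg (monMul M) (TensorProduct.zero_tmul M.X a)).trans (map_zero _)
    mul_zero := fun a => (congrArg (monMul M) (TensorProduct.tmul_zero M.X a)).trans (map_zero _)
    mul_assoc := monMul_assoc M
    one_mul := fun a => (monOne_mul M 1 a).trans (one_smul k a)
    mul_one := fun a => (monMul_one M 1 a).trans (one_smul k a) }

/-- The algebra structure of a monoid object of coalgebras. -/
@[reducible]
noncomputable def monAlgebra (M : Mon (CoalgCat.{u} k)) : @Algebra k M.X _ (monRing M).toSemiring :=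
  letI := monRing M
  Algebra.ofModule
    (fun r x y => (congrArg (monMul M) (TensorProduct.smul_tmul' r x y).symm).trans
      (map_smul (monMul M) r _))
    (fun r x y => (congrArg (monMul M) (TensorProduct.tmul_smul r x y)).trans
      (map_smul (monMul M) r _))

/-- The bialgebra structure of a monoid object of coalgebras. -/
@[reducible]
noncomputable def monBialgebra (M : Mon (CoalgCat.{u} k)) :
    @Bialgebra k M.X _ (monRing M).toSemiring :=
  letI := monRing M
  letI := monAlgebra M
  letI C : Coalgebra k M.X := M.X.instCoalgebra
  @Bialgebra.mk' k M.X _ _ _ C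
    (LinearMap.congr_fun (monOne M).counit_comp 1)
    (fun {a b} => (LinearMap.congr_fun (monMul M).counit_comp (a ⊗ₜ b)).trans
      ((TensorProduct.counit_tmul a b).trans (_root_.mul_comm _ _)))
    (LinearMap.congr_fun (monOne M).map_comp_comul 1).symm
    (fun {a b} => by
      refine (LinearMap.congr_fun (monMul M).map_comp_comul (a ⊗ₜ b)).symm.trans ?_
      exact map_tensorTensorTensorComm_eq_mul (m := (monMul M).toLinearMap) (fun _ _ => rfl)
        (C.comul a) (C.comul b))

instance : (bialgToMon k).EssSurj where
  mem_essImage M := by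
    let _ := monRing M
    let _ := monBialgebra M
    refine ⟨BialgCat.of k M.X, ⟨Mon.mkIso (N := M) (M := monOfBialg k (BialgCat.of k M.X))
      (Iso.refl M.X) ?_ ?_⟩⟩
    · apply CoalgCat.hom_ext
      apply CoalgHom.coe_linearMap_injective
      ext
      exact map_one (algebraMap k M.X)
    · apply CoalgCat.hom_ext
      apply CoalgHom.coe_linearMap_injective
      refine TensorProduct.ext' fun a b => ?_
      rfl

instance : (bialgToMon k).IsEquivalence where

variable (k)

/-- The forgetful functor from bialgebras to coalgebras factors over monoid objects. -/
noncomputable def bialgToMonForget :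
    bialgToMon k ⋙ Mon.forget (CoalgCat k) ≅ forget₂ (BialgCat.{u} k) (CoalgCat.{u} k) :=
  NatIso.ofComponents (fun _ => Iso.refl _) fun _ => rfl

/-- Forgetting a monoid structure creates limits; this is transported along the equivalence with
monoid objects. -/
noncomputable instance createsLimits_forget₂_bialg :
    CreatesLimitsOfSize.{w, w} (forget₂ (BialgCat.{u} k) (CoalgCat.{u} k)) :=
  createsLimitsOfNatIso (bialgToMonForget k)

end BialgMon

open Coalgebra WithConv LinearMap

/-! ### Functionals from the legs separate a limit of coalgebras. -/

section Separation

theorem exists_ring_range_eq {k B : Type u} [Field k] [Ring B] [Algebra k B] [FiniteDimensional k B]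
    (R : Subalgebra k B) : ∃ (A : Type u) (_ : Ring A) (_ : Algebra k A) (_ : FiniteDimensional k A)
      (j : A →ₐ[k] B), Function.Injective j ∧ j.range = R :=
  ⟨R, inferInstance, inferInstance, inferInstance, R.val, Subtype.val_injective, R.range_val⟩

/-- The quotient of a finite-dimensional coalgebra by the annihilator of a subalgebra of its
convolution algebra. -/
theorem exists_quotient {k E : Type u} [Field k] [AddCommGroup E] [Module k E] [Coalgebra k E]
    [FiniteDimensional k E] (R : Subalgebra k (WithConv (E →ₗ[k] k))) :
    ∃ (Q : Type u) (_ : AddCommGroup Q) (_ : Module k Q) (_ : Coalgebra k Q) (q : E →ₗc[k] Q),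
      (∀ e, (∀ r ∈ R, r e = 0) → q e = 0) ∧
      (∀ (X : Type u) [AddCommGroup X] [Module k X] [Coalgebra k X] (φ : E →ₗc[k] X),
        (∀ f : X →ₗ[k] k, toConv (f ∘ₗ φ.toLinearMap) ∈ R) → ∃ ψ : Q →ₗc[k] X, ψ.comp q = φ) ∧
      ∀ (X : Type u) [AddCommGroup X] [Module k X] [Coalgebra k X] (g h : Q →ₗc[k] X),
        g.comp q = h.comp q → g = h := by
  have : FiniteDimensional k (WithConv (E →ₗ[k] k)) :=
    Module.Finite.equiv (WithConv.linearEquiv k (E →ₗ[k] k)).symm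
  let l (X : Type u) [AddCommGroup X] [Module k X] [Coalgebra k X] :=
    Coalgebra.TensorProduct.lid k X
  obtain ⟨A, _, _, _, j, hj, rfl⟩ := exists_ring_range_eq R
  have hl (X : Type u) [AddCommGroup X] [Module k X] [Coalgebra k X]
      (ψ : Module.Dual k A →ₗc[k] X) (z : k ⊗[k] Module.Dual k A) :
      l X (Coalgebra.TensorProduct.map (CoalgHom.id k k) ψ z) = ψ (l _ z) := by
    induction z with
    | zero => simp only [map_zero]
    | add x y hx hy => rw [map_add, map_add, hx, hy, map_add, map_add]
    | tmul a x => exact (map_smul ψ a x).symm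
  refine ⟨Module.Dual k A, inferInstance, inferInstance, inferInstance,
    (l (Module.Dual k A) : _ →ₗc[k] _).comp (toDual j), fun e he => ?_,
    fun X _ _ _ φ hφ => ?_, fun X _ _ _ g h H => ?_⟩
  · refine (congrArg (l _) (?_ : toDual j e = 0)).trans (map_zero _)
    refine separates_extDual (k := k) _ fun f => ?_
    have := congr($(transpose_toDual' j (toConv f)) e)
    exact this.trans (he _ ⟨_, rfl⟩)
  · obtain ⟨ψ, hψ⟩ := exists_factor_toDual hj (((l X).symm : X →ₗc[k] k ⊗[k] X).comp φ)
      (isFinite_transpose _) (by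
        intro f
        have : transpose (((l X).symm : X →ₗc[k] k ⊗[k] X).comp φ) f =
            toConv (f.ofConv ∘ₗ φ.toLinearMap) :=
          WithConv.ext (LinearMap.ext fun e => mul_one (f.ofConv (φ e)))
        rw [this]
        exact hφ f.ofConv)
    refine ⟨ψ, CoalgHom.ext fun e => ?_⟩
    have := congr(l X ($hψ e))
    refine (hl X ψ _).symm.trans (this.trans ?_)
    exact (l X).apply_symm_apply (φ e)
  · refine toDual_epi hj (CoalgHom.ext fun e => (l X).injective ?_)
    exact (hl X g _).trans (congr($H e).trans (hl X h _).symm)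

variable {k : Type u} [Field k] {J : Type*} [Category J] {K : J ⥤ CoalgCat.{u} k} {c : Cone K}

/-- The functionals on a limit of coalgebras coming from the individual coalgebras generate a
separating algebra. -/
theorem eq_zero_of_adjoin (hc : IsLimit c) (y : c.pt)
    (h : ∀ f ∈ Algebra.adjoin k {f : WithConv (c.pt →ₗ[k] k) |
      ∃ (j : J) (g : K.obj j →ₗ[k] k), f = toConv (g ∘ₗ (c.π.app j).toCoalgHom.toLinearMap)},
      f y = 0) : y = 0 := by
  set A := Algebra.adjoin k {f : WithConv (c.pt →ₗ[k] k) |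
    ∃ (j : J) (g : K.obj j →ₗ[k] k), f = toConv (g ∘ₗ (c.π.app j).toCoalgHom.toLinearMap)}
  obtain ⟨E, _, _, _, _, i, hi, hy⟩ := exists_finite_subcoalgebra k (Set.finite_singleton y)
  obtain ⟨e, rfl⟩ := hy rfl
  -- Restriction of functionals to `E`, obtained as a transpose with `k' = k`.
  let res : WithConv (c.pt →ₗ[k] k) →ₐ[k] WithConv (E →ₗ[k] k) :=
    transpose (((Coalgebra.TensorProduct.lid k c.pt).symm : c.pt →ₗc[k] _).comp i)
  have hres (f) : res f = toConv (f.ofConv ∘ₗ i.toLinearMap) := by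
    ext e
    exact mul_one _
  obtain ⟨Q, _, _, _, q, hq, hfac, hepi⟩ := exists_quotient (A.map res)
  have hψ (j : J) : ∃ ψ : CoalgCat.of k Q ⟶ K.obj j,
      (CoalgCat.Hom.mk q : CoalgCat.of k E ⟶ CoalgCat.of k Q) ≫ ψ =
      (CoalgCat.Hom.mk i : CoalgCat.of k E ⟶ c.pt) ≫ c.π.app j := by
    obtain ⟨ψ, hψ⟩ := hfac (K.obj j) ((c.π.app j).toCoalgHom.comp i) fun f =>
      ⟨_, Algebra.subset_adjoin ⟨j, f, rfl⟩, hres _⟩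
    exact ⟨CoalgCat.Hom.mk ψ, CoalgCat.hom_ext _ _ hψ⟩
  choose ψ hψ using hψ
  have hepi' (X : CoalgCat.{u} k) (g h : CoalgCat.of k Q ⟶ X)
      (H : (CoalgCat.Hom.mk q : CoalgCat.of k E ⟶ CoalgCat.of k Q) ≫ g = CoalgCat.Hom.mk q ≫ h) :
      g = h := CoalgCat.hom_ext _ _ (hepi X _ _ (congrArg CoalgCat.Hom.toCoalgHom H))
  let t : Cone K :=
    { pt := CoalgCat.of k Q
      π :=
        { app := ψ
          naturality := fun i j f => by
            refine hepi' _ _ _ ?_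
            simp only [Functor.const_obj_obj, Functor.const_obj_map, Category.id_comp]
            rw [← Category.assoc, hψ, hψ, Category.assoc, c.w] } }
  -- The legs restricted to `E` factor through the quotient `Q`, hence so does the inclusion of `E`;
  -- and `q` kills `e` by the hypothesis on `y`.
  have H : (CoalgCat.Hom.mk q : CoalgCat.of k E ⟶ CoalgCat.of k Q) ≫ hc.lift t =
      CoalgCat.Hom.mk i := hc.hom_ext fun j => by
    rw [Category.assoc, hc.fac, hψ]
  refine (congr(CoalgCat.Hom.toCoalgHom $H e)).symm.trans ?_
  refine (congrArg (hc.lift t).toCoalgHom (hq e ?_)).trans (map_zero _)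
  rintro _ ⟨f, hf, rfl⟩
  exact (congr($(hres f) e)).trans (h f hf)

end Separation

/-! ### Convolution identities for antipodes. -/

section Convolution

variable {k : Type*} [Field k]

section

variable {A B C : Type*} [Ring A] [Algebra k A] [Ring B] [Algebra k B] [AddCommGroup C] [Module k C]
  [Coalgebra k C]

/-- Postcomposition with an algebra homomorphism respects convolution. -/
noncomputable def convMap (C : Type*) [AddCommGroup C] [Module k C] [Coalgebra k C]
    (i : A →ₐ[k] B) : WithConv (C →ₗ[k] A) →* WithConv (C →ₗ[k] B) where
  toFun f := toConv (i.toLinearMap ∘ₗ f.ofConv)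
  map_one' := WithConv.ext (LinearMap.ext fun c => i.commutes (counit c))
  map_mul' f g := WithConv.ext (algHom_comp_convMul_distrib i f g)

theorem comp_convMap_mul {i : A →ₐ[k] B} {P : B →ₗ[k] A} (hP : ∀ a b, P (i a * b) = a * P b)
    (f : WithConv (C →ₗ[k] A)) (g : WithConv (C →ₗ[k] B)) :
    toConv (P ∘ₗ (convMap C i f * g).ofConv) = f * toConv (P ∘ₗ g.ofConv) := by
  refine WithConv.ext (LinearMap.ext fun c => ?_)
  simp only [LinearMap.convMul_def, convMap, MonoidHom.coe_mk, OneHom.coe_mk, coe_comp,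
    Function.comp_apply]
  generalize (comul c : C ⊗[k] C) = z
  induction z with
  | zero => simp
  | add x y hx hy => simp only [map_add, hx, hy]
  | tmul x y => exact hP _ _

theorem comp_mul_convMap {i : A →ₐ[k] B} {P : B →ₗ[k] A} (hP : ∀ a b, P (b * i a) = P b * a)
    (f : WithConv (C →ₗ[k] A)) (g : WithConv (C →ₗ[k] B)) :
    toConv (P ∘ₗ (g * convMap C i f).ofConv) = toConv (P ∘ₗ g.ofConv) * f := by
  refine WithConv.ext (LinearMap.ext fun c => ?_)
  simp only [LinearMap.convMul_def, convMap, MonoidHom.coe_mk, OneHom.coe_mk, coe_comp,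
    Function.comp_apply]
  generalize (comul c : C ⊗[k] C) = z
  induction z with
  | zero => simp
  | add x y hx hy => simp only [map_add, hx, hy]
  | tmul x y => exact hP _ _

end

variable {L : Type*} [Ring L] [Bialgebra k L]

/-- The left inclusion on convolution algebras. -/
noncomputable abbrev convInl : WithConv (L →ₗ[k] L) →* WithConv (L →ₗ[k] L ⊗[k] L) :=
  convMap L (Algebra.TensorProduct.includeLeft : L →ₐ[k] L ⊗[k] L)

/-- The right inclusion on convolution algebras. -/
noncomputable abbrev convInr : WithConv (L →ₗ[k] L) →* WithConv (L →ₗ[k] L ⊗[k] L) :=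
  convMap L (Algebra.TensorProduct.includeRight : L →ₐ[k] L ⊗[k] L)

theorem toConv_comul : toConv (comul : L →ₗ[k] L ⊗[k] L) =
    convInl (toConv LinearMap.id) * convInr (toConv LinearMap.id) := by
  refine WithConv.ext (LinearMap.ext fun c => ?_)
  simp only [LinearMap.convMul_def, convMap, MonoidHom.coe_mk, OneHom.coe_mk, coe_comp,
    Function.comp_apply]
  generalize (comul c : L ⊗[k] L) = z
  induction z with
  | zero => simp
  | add x y hx hy => simpa only [map_add] using congrArg₂ (· + ·) hx hy
  | tmul x y => simp

theorem toConv_map_comm_comul (S : L →ₗ[k] L) :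
    toConv (TensorProduct.map S S ∘ₗ (TensorProduct.comm k L L).toLinearMap ∘ₗ comul) =
    convInr (toConv S) * convInl (toConv S) := by
  refine WithConv.ext (LinearMap.ext fun c => ?_)
  simp only [LinearMap.convMul_def, convMap, MonoidHom.coe_mk, OneHom.coe_mk, coe_comp,
    Function.comp_apply]
  generalize (comul c : L ⊗[k] L) = z
  induction z with
  | zero => simp
  | add x y hx hy => simpa only [map_add] using congrArg₂ (· + ·) hx hy
  | tmul x y => simp

/-- Both sides are convolution inverses of the comultiplication as a map `H → H ⊗ H`. -/
theorem comul_comp_antipode {H : Type*} [Ring H] [HopfAlgebra k H] :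
    (comul ∘ₗ HopfAlgebra.antipode k : H →ₗ[k] H ⊗[k] H) =
      TensorProduct.map (HopfAlgebra.antipode k) (HopfAlgebra.antipode k) ∘ₗ
        (TensorProduct.comm k H H).toLinearMap ∘ₗ comul := by
  refine WithConv.toConv_injective ?_
  refine (left_inv_eq_right_inv (a := toConv (comul : H →ₗ[k] H ⊗[k] H)) ?_ LinearMap.comul_right_inv).symm
  let S : WithConv (H →ₗ[k] H) := toConv (HopfAlgebra.antipode k)
  let e : WithConv (H →ₗ[k] H) := toConv LinearMap.id
  have h : S * e = 1 := LinearMap.antipode_mul_id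
  rw [toConv_map_comm_comul, toConv_comul]
  calc convInr S * convInl S * (convInl e * convInr e)
      = convInr S * convInl (S * e) * convInr e := by rw [map_mul]; simp only [mul_assoc]
    _ = 1 := by rw [h, map_one, mul_one, ← map_mul, h, map_one]

/-- Both composites are convolution inverses of `f`. -/
theorem map_antipode {H H' : Type*} [Ring H] [HopfAlgebra k H] [Ring H'] [HopfAlgebra k H']
    (f : H →ₐc[k] H') (x : H) : f (HopfAlgebra.antipode k x) = HopfAlgebra.antipode k (f x) := by
  let φ : H →ₗc[k] H' := f
  have h1 : toConv (φ.toLinearMap ∘ₗ HopfAlgebra.antipode k) * toConv φ.toLinearMap = 1 := by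
    refine (map_mul (convMap H (f : H →ₐ[k] H')) (toConv (HopfAlgebra.antipode k))
      (toConv LinearMap.id)).symm.trans ?_
    rw [LinearMap.antipode_mul_id, map_one]
  have h2 : toConv φ.toLinearMap * toConv (HopfAlgebra.antipode k ∘ₗ φ.toLinearMap) = 1 := by
    have := convMul_comp_coalgHom_distrib (toConv (LinearMap.id : H' →ₗ[k] H'))
      (toConv (HopfAlgebra.antipode k)) φ
    rw [LinearMap.id_mul_antipode] at this
    refine (WithConv.ext this.symm).trans (WithConv.ext (LinearMap.ext fun x => ?_))
    exact congrArg (algebraMap k H') (LinearMap.congr_fun φ.counit_comp x)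
  have h := left_inv_eq_right_inv h1 h2
  exact congr($h x)

/-- The map `a ⊗ b ↦ f(a) b`. -/
noncomputable def sliceLeft (f : L →ₗ[k] k) : L ⊗[k] L →ₗ[k] L :=
  (TensorProduct.lid k L).toLinearMap ∘ₗ f.rTensor L

/-- The map `a ⊗ b ↦ f(b) a`. -/
noncomputable def sliceRight (f : L →ₗ[k] k) : L ⊗[k] L →ₗ[k] L :=
  (TensorProduct.rid k L).toLinearMap ∘ₗ f.lTensor L

theorem convMul_apply_sliceLeft (f g : L →ₗ[k] k) (φ : L →ₗ[k] L) (c : L) :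
    (toConv f * toConv g) (φ c) = g (sliceLeft f (comul (φ c))) := by
  rw [convMul_apply_eq_pairing]
  generalize (comul (φ c) : L ⊗[k] L) = z
  induction z with
  | zero => simp
  | add x y hx hy => simp only [map_add, hx, hy]
  | tmul x y => simp [sliceLeft]

theorem convMul_apply_sliceRight (f g : L →ₗ[k] k) (φ : L →ₗ[k] L) (c : L) :
    (toConv f * toConv g) (φ c) = f (sliceRight g (comul (φ c))) := by
  rw [convMul_apply_eq_pairing]
  generalize (comul (φ c) : L ⊗[k] L) = z
  induction z with
  | zero => simp
  | add x y hx hy => simp only [map_add, hx, hy]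
  | tmul x y => simp [sliceRight, mul_comm]

/-- The convolution product of an endomorphism with the identity. -/
noncomputable def convLeft (S : L →ₗ[k] L) : WithConv (L →ₗ[k] L) :=
  toConv S * toConv LinearMap.id

/-- The convolution product of the identity with an endomorphism. -/
noncomputable def convRight (S : L →ₗ[k] L) : WithConv (L →ₗ[k] L) :=
  toConv LinearMap.id * toConv S

section Antipode

variable {S : L →ₗ[k] L}
  (hS : comul ∘ₗ S = TensorProduct.map S S ∘ₗ (TensorProduct.comm k L L).toLinearMap ∘ₗ comul)

include hS

/-- Comultiplication is an algebra map, so it distributes over the convolution; by `hS` the two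
left-leg factors become adjacent and merge into `S * id`. -/
theorem comul_comp_convLeft : toConv (comul ∘ₗ (convLeft S).ofConv) =
    convInr (toConv S) * convInl (convLeft S) *
      convInr (toConv LinearMap.id) := by
  have h := map_mul (convMap L (Bialgebra.comulAlgHom k L)) (toConv S) (toConv LinearMap.id)
  refine h.trans ?_
  have h1 : convMap L (Bialgebra.comulAlgHom k L) (toConv S) =
      convInr (toConv S) * convInl (toConv S) := by
    rw [← toConv_map_comm_comul, ← hS]
    rfl
  have h2 : convMap L (Bialgebra.comulAlgHom k L) (toConv LinearMap.id) =
      convInl (toConv LinearMap.id) * convInr (toConv LinearMap.id) := toConv_comul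
  rw [h1, h2, convLeft, map_mul]
  simp only [mul_assoc]

theorem comul_comp_convRight : toConv (comul ∘ₗ (convRight S).ofConv) =
    convInl (toConv LinearMap.id) * (convInr (convRight S) *
      convInl (toConv S)) := by
  have h := map_mul (convMap L (Bialgebra.comulAlgHom k L)) (toConv LinearMap.id) (toConv S)
  refine h.trans ?_
  have h1 : convMap L (Bialgebra.comulAlgHom k L) (toConv S) =
      convInr (toConv S) * convInl (toConv S) := by
    rw [← toConv_map_comm_comul, ← hS]
    rfl
  have h2 : convMap L (Bialgebra.comulAlgHom k L) (toConv LinearMap.id) =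
      convInl (toConv LinearMap.id) * convInr (toConv LinearMap.id) := toConv_comul
  rw [h1, h2, convRight, map_mul]
  simp only [mul_assoc]

/-- Slicing the left leg by `f` is linear over the right leg, so it touches only the middle factor
of `comul_comp_convLeft`, which `hf` collapses to `f 1` times the unit. -/
theorem sliceLeft_comul_convLeft {f : L →ₗ[k] k}
    (hf : ∀ c, f (convLeft S c) = f 1 * counit c) (c : L) :
    sliceLeft f (comul (convLeft S c)) =
      f 1 • convLeft S c := by
  have h : toConv (sliceLeft f ∘ₗ comul ∘ₗ (convLeft S).ofConv) =
      f 1 • convLeft S := by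
    have h1 := congrArg (fun t => toConv (sliceLeft f ∘ₗ t.ofConv)) (comul_comp_convLeft hS)
    refine h1.trans ?_
    have hl (a : L) (z : L ⊗[k] L) :
        sliceLeft f (Algebra.TensorProduct.includeRight a * z) = a * sliceLeft f z := by
      induction z with
      | zero => simp
      | add x y hx hy => simp only [map_add, mul_add, hx, hy]
      | tmul x y => simp [sliceLeft]
    have hr (a : L) (z : L ⊗[k] L) :
        sliceLeft f (z * Algebra.TensorProduct.includeRight a) = sliceLeft f z * a := by
      induction z with
      | zero => simp
      | add x y hx hy => simp only [map_add, add_mul, hx, hy]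
      | tmul x y => simp [sliceLeft]
    rw [comp_mul_convMap hr, comp_convMap_mul hl]
    have : toConv (sliceLeft f ∘ₗ (convInl (convLeft S)).ofConv) =
        f 1 • (1 : WithConv (L →ₗ[k] L)) := by
      refine WithConv.ext (LinearMap.ext fun c => ?_)
      have : f (convLeft S c) • (1 : L) = f 1 • algebraMap k L (counit c) := by
        rw [hf, Algebra.algebraMap_eq_smul_one, smul_smul]
      exact this
    rw [this, mul_smul_comm, smul_mul_assoc, mul_one, convLeft]
  exact congr($h c)

theorem sliceRight_comul_convRight {f : L →ₗ[k] k}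
    (hf : ∀ c, f (convRight S c) = f 1 * counit c) (c : L) :
    sliceRight f (comul (convRight S c)) =
      f 1 • convRight S c := by
  have h : toConv (sliceRight f ∘ₗ comul ∘ₗ (convRight S).ofConv) =
      f 1 • convRight S := by
    have h1 := congrArg (fun t => toConv (sliceRight f ∘ₗ t.ofConv)) (comul_comp_convRight hS)
    refine h1.trans ?_
    have hl (a : L) (z : L ⊗[k] L) :
        sliceRight f ((Algebra.TensorProduct.includeLeft : L →ₐ[k] L ⊗[k] L) a * z) =
          a * sliceRight f z := by
      induction z with
      | zero => simp
      | add x y hx hy => simp only [map_add, mul_add, hx, hy]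
      | tmul x y => simp [sliceRight]
    have hr (a : L) (z : L ⊗[k] L) :
        sliceRight f (z * (Algebra.TensorProduct.includeLeft : L →ₐ[k] L ⊗[k] L) a) =
          sliceRight f z * a := by
      induction z with
      | zero => simp
      | add x y hx hy => simp only [map_add, add_mul, hx, hy]
      | tmul x y => simp [sliceRight]
    rw [comp_convMap_mul hl, comp_mul_convMap hr]
    have : toConv (sliceRight f ∘ₗ (convInr (convRight S)).ofConv) =
        f 1 • (1 : WithConv (L →ₗ[k] L)) := by
      refine WithConv.ext (LinearMap.ext fun c => ?_)
      have : f (convRight S c) • (1 : L) = f 1 • algebraMap k L (counit c) := by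
        rw [hf, Algebra.algebraMap_eq_smul_one, smul_smul]
      exact this
    rw [this, smul_mul_assoc, one_mul, mul_smul_comm, convRight]
  exact congr($h c)

end Antipode

end Convolution

/-- The co-opposite of a coalgebra: the same space, with the flipped comultiplication. -/
def Cop (C : Type*) : Type _ := C

/-! ### Co-opposite coalgebras. -/

namespace Cop

variable {k C D : Type*} [Field k] [AddCommGroup C] [Module k C] [AddCommGroup D] [Module k D]

instance : AddCommGroup (Cop C) := inferInstanceAs (AddCommGroup C)

instance : Module k (Cop C) := inferInstanceAs (Module k C)

/-- The flipped comultiplication. -/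
noncomputable def comul' (k C : Type*) [Field k] [AddCommGroup C] [Module k C] [Coalgebra k C] :
    C →ₗ[k] C ⊗[k] C :=
  (TensorProduct.comm k C C).toLinearMap ∘ₗ Coalgebra.comul

section

variable [Coalgebra k C]

theorem assoc_rTensor_comul' (z : C ⊗[k] C) :
    TensorProduct.assoc k C C C ((comul' k C).rTensor C (TensorProduct.comm k C C z)) =
      TensorProduct.assoc k C C C (TensorProduct.comm k C (C ⊗[k] C)
        ((TensorProduct.comm k C C).toLinearMap.lTensor C
          ((Coalgebra.comul : C →ₗ[k] C ⊗[k] C).lTensor C z))) := by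
  induction z with
  | zero => simp only [map_zero]
  | add x y hx hy => simp only [map_add, hx, hy]
  | tmul x y => rfl

theorem lTensor_comul' (z : C ⊗[k] C) :
    (comul' k C).lTensor C (TensorProduct.comm k C C z) =
      TensorProduct.assoc k C C C (TensorProduct.comm k C (C ⊗[k] C)
        ((TensorProduct.comm k C C).toLinearMap.lTensor C
          (TensorProduct.assoc k C C C
            ((Coalgebra.comul : C →ₗ[k] C ⊗[k] C).rTensor C z)))) := by
  induction z with
  | zero => simp only [map_zero]
  | add x y hx hy => simp only [map_add, hx, hy]
  | tmul x y =>
    simp only [comul', TensorProduct.comm_tmul, lTensor_tmul, rTensor_tmul, coe_comp,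
      Function.comp_apply, LinearEquiv.coe_coe]
    generalize (Coalgebra.comul x : C ⊗[k] C) = w
    induction w with
    | zero => simp
    | add a b ha hb => simp only [map_add, TensorProduct.tmul_add, TensorProduct.add_tmul, ha, hb]
    | tmul a b => rfl

theorem rTensor_counit_comul' (c : C) :
    (Coalgebra.counit : C →ₗ[k] k).rTensor C (comul' k C c) = 1 ⊗ₜ c := by
  have h := congr(TensorProduct.comm k C k $(Coalgebra.lTensor_counit_comul (R := k) c))
  refine Eq.trans ?_ h
  simp only [comul', coe_comp, Function.comp_apply, LinearEquiv.coe_coe]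
  generalize (Coalgebra.comul c : C ⊗[k] C) = w
  induction w with
  | zero => simp
  | add a b ha hb => simp only [map_add, ha, hb]
  | tmul a b => rfl

theorem lTensor_counit_comul' (c : C) :
    (Coalgebra.counit : C →ₗ[k] k).lTensor C (comul' k C c) = c ⊗ₜ 1 := by
  have h := congr(TensorProduct.comm k k C $(Coalgebra.rTensor_counit_comul (R := k) c))
  refine Eq.trans ?_ h
  simp only [comul', coe_comp, Function.comp_apply, LinearEquiv.coe_coe]
  generalize (Coalgebra.comul c : C ⊗[k] C) = w
  induction w with
  | zero => simp
  | add a b ha hb => simp only [map_add, ha, hb]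
  | tmul a b => rfl

noncomputable instance : CoalgebraStruct k (Cop C) where
  comul := comul' k C
  counit := (Coalgebra.counit : C →ₗ[k] k)

noncomputable instance : Coalgebra k (Cop C) where
  coassoc := LinearMap.ext fun c =>
    (assoc_rTensor_comul' (Coalgebra.comul c : C ⊗[k] C)).trans
      ((congrArg (fun z => TensorProduct.assoc k C C C (TensorProduct.comm k C (C ⊗[k] C)
        ((TensorProduct.comm k C C).toLinearMap.lTensor C z)))
          (Coalgebra.coassoc_apply (R := k) (A := C) c).symm).trans
            (lTensor_comul' (Coalgebra.comul c : C ⊗[k] C)).symm)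
  rTensor_counit_comp_comul := LinearMap.ext fun c => rTensor_counit_comul' (k := k) (C := C) c
  lTensor_counit_comp_comul := LinearMap.ext fun c => lTensor_counit_comul' (k := k) (C := C) c

/-- A coalgebra homomorphism between the co-opposite coalgebras. -/
noncomputable def map [Coalgebra k D] (f : C →ₗc[k] D) : Cop C →ₗc[k] Cop D where
  toLinearMap := (f.toLinearMap : C →ₗ[k] D)
  counit_comp := f.counit_comp
  map_comp_comul := LinearMap.ext fun c => by
    have h := congr(TensorProduct.comm k D D ($(f.map_comp_comul) c))
    refine Eq.trans ?_ h
    change TensorProduct.map f.toLinearMap f.toLinearMap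
      (TensorProduct.comm k C C (Coalgebra.comul c)) = TensorProduct.comm k D D
        (TensorProduct.map f.toLinearMap f.toLinearMap (Coalgebra.comul c))
    generalize (Coalgebra.comul c : C ⊗[k] C) = w
    induction w with
    | zero => simp
    | add a b ha hb => simp only [_root_.map_add, ha, hb]
    | tmul a b => rfl

end

/-- The antipode as a coalgebra homomorphism from the co-opposite coalgebra. -/
noncomputable def antipode (k H : Type*) [Field k] [Ring H] [HopfAlgebra k H] :
    Cop H →ₗc[k] H where
  toLinearMap := (HopfAlgebra.antipode k : H →ₗ[k] H)
  counit_comp := HopfAlgebra.counit_comp_antipode (R := k) (A := H)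
  map_comp_comul := (comul_comp_antipode (k := k) (H := H)).symm

end Cop

/-! ### The antipode on a limit of Hopf algebras. -/

section LimitAntipode

variable {k : Type u} [Field k] {J : Type*} [Category J] {K : J ⥤ HopfAlgCat.{u} k}
  {c : Cone (K ⋙ forget₂ (HopfAlgCat.{u} k) (BialgCat.{u} k))}

/-- The components of a cone over Hopf algebras, as bialgebra homomorphisms. -/
def leg (c : Cone (K ⋙ forget₂ (HopfAlgCat.{u} k) (BialgCat.{u} k))) (j : J) :
    c.pt →ₐc[k] K.obj j :=
  (c.π.app j).toBialgHom

/-- Antipodes are coalgebra maps from the co-opposite and commute with bialgebra maps, so composed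
with the legs they form a cone to lift. -/
theorem exists_coalgHom_cop
    (hc : IsLimit ((forget₂ (BialgCat.{u} k) (CoalgCat.{u} k)).mapCone c)) :
    ∃ S : Cop c.pt →ₗc[k] c.pt, ∀ (j : J) (x : c.pt), leg c j (S x) =
      HopfAlgebra.antipode k (leg c j x) := by
  let t : Cone ((K ⋙ forget₂ (HopfAlgCat.{u} k) (BialgCat.{u} k)) ⋙
      forget₂ (BialgCat.{u} k) (CoalgCat.{u} k)) :=
    { pt := CoalgCat.of k (Cop c.pt)
      π :=
        { app := fun j => CoalgCat.ofHom ((Cop.antipode k (K.obj j)).comp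
            (Cop.map (leg c j : c.pt →ₗc[k] K.obj j)))
          naturality := fun i j f => by
            refine CoalgCat.hom_ext _ _ (CoalgHom.ext fun x => ?_)
            have h : (K.map f).toBialgHom (leg c i x) = leg c j x :=
              congr(BialgCat.Hom.toBialgHom $(c.w f) x)
            refine (congrArg (HopfAlgebra.antipode k (A := K.obj j)) h.symm).trans ?_
            exact (map_antipode (K.map f).toBialgHom (leg c i x)).symm } }
  exact ⟨(hc.lift t).toCoalgHom, fun j x => congr(CoalgCat.Hom.toCoalgHom $(hc.fac t j) x)⟩

theorem convMul_apply_one {L : Type*} [Ring L] [Bialgebra k L] (f g : WithConv (L →ₗ[k] k)) :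
    (f * g) 1 = f 1 * g 1 := by
  rw [convMul_apply_eq_pairing, Bialgebra.comul_one, Algebra.TensorProduct.one_def, pairing_tmul]

theorem counit_convMul_apply {L : Type*} [Ring L] [Bialgebra k L] {f g : L →ₗ[k] L}
    (hf : ∀ c, counit (R := k) (f c) = counit c) (hg : ∀ c, counit (R := k) (g c) = counit c)
    (c : L) : counit (R := k) ((toConv f * toConv g) c) = counit c := by
  have h := map_mul (convMap L (Bialgebra.counitAlgHom k L)) (toConv f) (toConv g)
  have h1 : convMap L (Bialgebra.counitAlgHom k L) (toConv f) = 1 :=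
    WithConv.ext (LinearMap.ext hf)
  have h2 : convMap L (Bialgebra.counitAlgHom k L) (toConv g) = 1 :=
    WithConv.ext (LinearMap.ext hg)
  rw [h1, h2, mul_one] at h
  exact congr($h c)

theorem eq_zero_of_adjoin_leg
    (hc : IsLimit ((forget₂ (BialgCat.{u} k) (CoalgCat.{u} k)).mapCone c)) (y : c.pt)
    (h : ∀ f ∈ Algebra.adjoin k {f : WithConv (c.pt →ₗ[k] k) | ∃ (j : J) (g : K.obj j →ₗ[k] k),
      f = toConv (g ∘ₗ (leg c j : c.pt →ₗc[k] K.obj j).toLinearMap)}, f y = 0) : y = 0 :=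
  eq_zero_of_adjoin hc y h

/-- The functionals `f` with `f ∘ X = f(1) ε` contain those coming from the legs and the scalars,
and are closed under sums and convolution; such functionals separate the points of the limit. -/
theorem eq_one_of_isLimit (hc : IsLimit ((forget₂ (BialgCat.{u} k) (CoalgCat.{u} k)).mapCone c))
    {X : WithConv (c.pt →ₗ[k] c.pt)} (hX : ∀ x, counit (R := k) (X x) = counit x)
    (hπ : ∀ j x, leg c j (X x) = algebraMap k (K.obj j) (counit x))
    (hmul : ∀ f g : c.pt →ₗ[k] k, (∀ x, f (X x) = f 1 * counit x) →
      (∀ x, g (X x) = g 1 * counit x) → ∀ x, (toConv f * toConv g) (X x) = f 1 * g 1 * counit x) :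
    X = 1 := by
  refine WithConv.ext (LinearMap.ext fun x => sub_eq_zero.1 ?_)
  refine eq_zero_of_adjoin_leg hc _ fun f hf => ?_
  suffices H : ∀ x : c.pt, f (X x) = f 1 * counit x by
    have h1 : f (algebraMap k c.pt (counit x)) = f 1 * counit x := by
      rw [Algebra.algebraMap_eq_smul_one]
      exact (map_smul f.ofConv _ _).trans (mul_comm _ _)
    exact (map_sub f.ofConv _ _).trans (sub_eq_zero.2 ((H x).trans h1.symm))
  induction hf using Algebra.adjoin_induction with
  | mem f hf =>
    obtain ⟨j, g, rfl⟩ := hf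
    intro x
    have h1 : g (leg c j (X x)) = g 1 * counit x := by
      rw [hπ, Algebra.algebraMap_eq_smul_one]
      exact (map_smul g _ _).trans (mul_comm _ _)
    exact h1.trans (congrArg (fun t => g t * counit x) (map_one (leg c j)).symm)
  | algebraMap r =>
    intro x
    have h (y : c.pt) : (algebraMap k (WithConv (c.pt →ₗ[k] k)) r) y = r * counit y := by
      rw [Algebra.algebraMap_eq_smul_one]
      rfl
    refine (h _).trans ((congrArg (r * ·) (hX x)).trans ?_)
    have h1 := (h 1).trans (congrArg (r * ·) (Bialgebra.counit_one (R := k) (A := c.pt)))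
    exact congrArg (· * counit x) (h1.trans (mul_one r)).symm
  | add f g _ _ hf hg =>
    intro x
    exact (congrArg₂ (· + ·) (hf x) (hg x)).trans (add_mul _ _ _).symm
  | mul f g _ _ hf hg =>
    intro x
    refine (hmul f.ofConv g.ofConv hf hg x).trans ?_
    exact congrArg (· * counit x) (convMul_apply_one f g).symm

/-- A limit of Hopf algebras in the category of bialgebras which is preserved by the forgetful
functor to coalgebras has an antipode. -/
theorem exists_antipode (hc : IsLimit ((forget₂ (BialgCat.{u} k) (CoalgCat.{u} k)).mapCone c)) :
    ∃ S : c.pt →ₗ[k] c.pt, convLeft S = 1 ∧ convRight S = 1 := by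
  obtain ⟨S', hS'⟩ := exists_coalgHom_cop hc
  let S : c.pt →ₗ[k] c.pt := S'.toLinearMap
  have hS : comul ∘ₗ S = TensorProduct.map S S ∘ₗ
      (TensorProduct.comm k c.pt c.pt).toLinearMap ∘ₗ comul := S'.map_comp_comul.symm
  have hε (x : c.pt) : counit (R := k) (S x) = counit x := LinearMap.congr_fun S'.counit_comp x
  let π (j : J) : c.pt →ₗc[k] K.obj j := (leg c j : c.pt →ₗc[k] K.obj j)
  let ρ (j : J) : c.pt →ₐ[k] K.obj j := (leg c j : c.pt →ₐ[k] K.obj j)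
  have hπS (j : J) : convMap c.pt (ρ j) (toConv S) =
      toConv (HopfAlgebra.antipode k (A := K.obj j) ∘ₗ (π j).toLinearMap) :=
    WithConv.ext (LinearMap.ext (hS' j))
  have hπ1 (j : J) (x : c.pt) : algebraMap k (K.obj j) (counit (π j x)) =
      algebraMap k (K.obj j) (counit x) :=
    congrArg _ (LinearMap.congr_fun (π j).counit_comp x)
  refine ⟨S, eq_one_of_isLimit hc (counit_convMul_apply hε fun _ => rfl) (fun j x => ?_)
    (fun f g hf hg x => ?_), eq_one_of_isLimit hc (counit_convMul_apply (fun _ => rfl) hε)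
      (fun j x => ?_) (fun f g hf hg x => ?_)⟩
  · have h := map_mul (convMap c.pt (ρ j)) (toConv S) (toConv LinearMap.id)
    have hid : convMap c.pt (ρ j) (toConv LinearMap.id) = toConv (π j).toLinearMap := rfl
    rw [hπS, hid] at h
    have h' := convMul_comp_coalgHom_distrib (toConv (HopfAlgebra.antipode k (A := K.obj j)))
      (toConv LinearMap.id) (π j)
    rw [LinearMap.antipode_mul_id] at h'
    exact (congr($h x)).trans ((LinearMap.congr_fun h' x).symm.trans (hπ1 j x))
  · rw [convMul_apply_sliceLeft f g (convLeft S).ofConv x]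
    refine (congrArg g (sliceLeft_comul_convLeft hS hf x)).trans ?_
    rw [map_smul, hg, smul_eq_mul, mul_assoc]
  · have h := map_mul (convMap c.pt (ρ j)) (toConv LinearMap.id) (toConv S)
    have hid : convMap c.pt (ρ j) (toConv LinearMap.id) = toConv (π j).toLinearMap := rfl
    rw [hπS, hid] at h
    have h' := convMul_comp_coalgHom_distrib (toConv LinearMap.id)
      (toConv (HopfAlgebra.antipode k (A := K.obj j))) (π j)
    rw [LinearMap.id_mul_antipode] at h'
    exact (congr($h x)).trans ((LinearMap.congr_fun h' x).symm.trans (hπ1 j x))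
  · rw [convMul_apply_sliceRight f g (convRight S).ofConv x]
    refine (congrArg f (sliceRight_comul_convRight hS hg x)).trans ?_
    rw [map_smul, hf, smul_eq_mul]
    ring

end LimitAntipode

end ScalarExt

namespace ScalarExt

/-! ### Creation of limits of Hopf algebras. -/

section HopfLimits

open Coalgebra WithConv LinearMap

variable {k : Type u} [Field k]

/-- The Hopf algebra structure on a bialgebra given by an antipode. -/
noncomputable def hopfOfAntipode (B : BialgCat.{u} k) (S : B →ₗ[k] B) (h : convLeft S = 1)
    (h' : convRight S = 1) : HopfAlgCat.{u} k :=
  letI : HopfAlgebra k B :=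
    { antipode := S
      mul_antipode_rTensor_comul := congrArg WithConv.ofConv h
      mul_antipode_lTensor_comul := congrArg WithConv.ofConv h' }
  HopfAlgCat.of k B

/-- The forgetful functor from Hopf algebras to bialgebras is fully faithful. -/
def fullyFaithfulForget₂Hopf (k : Type u) [Field k] :
    (forget₂ (HopfAlgCat.{u} k) (BialgCat.{u} k)).FullyFaithful where
  preimage f := HopfAlgCat.Hom.mk f.toBialgHom

instance : (forget₂ (HopfAlgCat.{u} k) (BialgCat.{u} k)).Full := (fullyFaithfulForget₂Hopf k).full

instance : (forget₂ (HopfAlgCat.{u} k) (BialgCat.{u} k)).Faithful :=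
  (fullyFaithfulForget₂Hopf k).faithful

instance (J : Type) [SmallCategory J] : HasLimitsOfShape J (CoalgCat.{u} k) :=
  have := hasLimitsOfSizeShrink.{0, 0, u, u} (CoalgCat.{u} k)
  inferInstance

instance (J : Type) [SmallCategory J] : HasLimitsOfShape J (BialgCat.{u} k) :=
  hasLimitsOfShape_of_hasLimitsOfShape_createsLimitsOfShape
    (forget₂ (BialgCat.{u} k) (CoalgCat.{u} k))

instance (J : Type) [SmallCategory J] :
    PreservesLimitsOfShape J (forget₂ (BialgCat.{u} k) (CoalgCat.{u} k)) :=
  preservesLimitOfShape_of_createsLimitsOfShape_and_hasLimitsOfShape _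

/-- Hopf algebras are full in bialgebras, so it suffices that the bialgebra limit carries an
antipode. -/
noncomputable instance {J : Type} [SmallCategory J] (K : J ⥤ HopfAlgCat.{u} k) :
    CreatesLimit K (forget₂ (HopfAlgCat.{u} k) (BialgCat.{u} k)) :=
  let h := exists_antipode (isLimitOfPreserves (forget₂ (BialgCat.{u} k) (CoalgCat.{u} k))
    (limit.isLimit (K ⋙ forget₂ (HopfAlgCat.{u} k) (BialgCat.{u} k))))
  createsLimitOfFullyFaithfulOfIso
    (hopfOfAntipode _ h.choose h.choose_spec.1 h.choose_spec.2) (Iso.refl _)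

end HopfLimits

/-! ### Transfer of preservation along forgetful functors. -/

section Transfer

variable {B B' C C' : Type*} [Category B] [Category B'] [Category C] [Category C']
  {J : Type*} [Category J]

/-- Created limits are both preserved and reflected: forwards, the image under `U` of a limit cone
is a limit cone on which `G` can be tested; backwards, `U'` reflects. -/
theorem preservesLimit_iff_of_createsLimit {U : B ⥤ C} {U' : B' ⥤ C'} {F : B ⥤ B'} {G : C ⥤ C'}
    (e : F ⋙ U' ≅ U ⋙ G) (K : J ⥤ B) [CreatesLimit K U] [HasLimit (K ⋙ U)]
    [CreatesLimit (K ⋙ F) U'] [HasLimit ((K ⋙ F) ⋙ U')] :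
    PreservesLimit K F ↔ PreservesLimit (K ⋙ U) G := by
  constructor
  · intro h
    have := preservesLimit_of_natIso K e
    have := hasLimit_of_created K U
    exact preservesLimit_of_preserves_limit_cone
      (isLimitOfPreserves U (limit.isLimit K)) (isLimitOfPreserves (U ⋙ G) (limit.isLimit K))
  · intro h
    have := preservesLimit_of_natIso K e.symm
    exact preservesLimit_of_reflects_of_preserves F U'

variable (k k' : Type u) [Field k] [Field k'] [Algebra k k']

/-- Scalar extension commutes with forgetting the multiplication of a bialgebra. -/
noncomputable def bialgForgetIso :
    bialg k k' ⋙ forget₂ (BialgCat.{u} k') (CoalgCat.{u} k') ≅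
      forget₂ (BialgCat.{u} k) (CoalgCat.{u} k) ⋙ coalg k k' :=
  NatIso.ofComponents (fun _ => Iso.refl _) fun _ => rfl

/-- The forgetful functor from Hopf algebras to coalgebras. -/
abbrev hopfForget : HopfAlgCat.{u} k ⥤ CoalgCat.{u} k :=
  forget₂ (HopfAlgCat.{u} k) (BialgCat.{u} k) ⋙ forget₂ (BialgCat.{u} k) (CoalgCat.{u} k)

/-- Scalar extension commutes with forgetting the multiplication of a Hopf algebra. -/
noncomputable def hopfForgetIso : hopf k k' ⋙ hopfForget k' ≅ hopfForget k ⋙ coalg k k' :=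
  NatIso.ofComponents (fun _ => Iso.refl _) fun _ => rfl

variable {k k'} {J : Type} [SmallCategory J]

theorem preservesLimit_bialg_iff (K : J ⥤ BialgCat.{u} k) : PreservesLimit K (bialg k k') ↔
    PreservesLimit (K ⋙ forget₂ (BialgCat.{u} k) (CoalgCat.{u} k)) (coalg k k') :=
  preservesLimit_iff_of_createsLimit (bialgForgetIso k k') K

theorem preservesLimit_hopf_iff (K : J ⥤ HopfAlgCat.{u} k) : PreservesLimit K (hopf k k') ↔
    PreservesLimit (K ⋙ hopfForget k) (coalg k k') :=
  preservesLimit_iff_of_createsLimit (hopfForgetIso k k') K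

theorem preservesBinaryPower_coalg_of_bialg {H : BialgCat.{u} k}
    (h : PreservesBinaryPower (bialg k k') H) :
    PreservesBinaryPower (coalg k k') (CoalgCat.of k H) :=
  have := (preservesLimit_bialg_iff _).1 h
  preservesLimit_of_iso_diagram _
    (pairComp H H (forget₂ (BialgCat.{u} k) (CoalgCat.{u} k)))

theorem preservesBinaryPower_coalg_of_hopf {H : HopfAlgCat.{u} k}
    (h : PreservesBinaryPower (hopf k k') H) :
    PreservesBinaryPower (coalg k k') (CoalgCat.of k H) :=
  have := (preservesLimit_hopf_iff _).1 h
  preservesLimit_of_iso_diagram _ (pairComp H H (hopfForget k))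

end Transfer

/-! ### Formal implications between the conditions, and the witness. -/

section Implications

variable {C D : Type*} [Category C] [Category D] {F : C ⥤ D}

theorem preservesFinitePowers_of_preservesFiniteProducts [PreservesFiniteProducts F] :
    PreservesFinitePowers F := fun _ _ _ => inferInstance

theorem preservesBinaryProducts_of_preservesFiniteProducts [PreservesFiniteProducts F] :
    PreservesBinaryProducts F := fun _ _ => inferInstance

theorem PreservesBinaryProducts.preservesBinaryPowers (h : PreservesBinaryProducts F) :
    PreservesBinaryPowers F := fun X => h X X

theorem PreservesFinitePowers.preservesBinaryPowers (h : PreservesFinitePowers F) :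
    PreservesBinaryPowers F := fun X =>
  have := h WalkingPair X
  preservesLimit_of_iso_diagram F (diagramIsoPair (Discrete.functor fun _ : WalkingPair => X))

end Implications

/-- The group algebra of the group with two elements. -/
abbrev GroupAlgebraTwo (k : Type u) [Field k] : Type u :=
  MonoidAlgebra k (Multiplicative (ZMod 2))

theorem finrank_groupAlgebraTwo (k : Type u) [Field k] :
    Module.finrank k (GroupAlgebraTwo k) = 2 := by
  rw [LinearEquiv.finrank_eq (MonoidAlgebra.coeffLinearEquiv k)]; simp

end ScalarExt

theorem mainTheorem6 (k k' : Type u) [Field k] [Field k'] [Algebra k k'] :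
    List.TFAE [
      -- the extension is algebraic
      Algebra.IsAlgebraic k k',
      -- finite, resp. binary, products of finite-dimensional coalgebras are preserved
      ∀ (ι : Type) [Finite ι] (X : ι → CoalgCat.{u} k), (∀ i, FiniteDimensional k (X i)) →
        PreservesLimit (Discrete.functor X) (ScalarExt.coalg k k'),
      ∀ X Y : CoalgCat.{u} k, FiniteDimensional k X → FiniteDimensional k Y →
        PreservesLimit (pair X Y) (ScalarExt.coalg k k'),
      -- finite limits, finite products, binary products of coalgebras are preserved
      PreservesFiniteLimits (ScalarExt.coalg k k'),
      PreservesFiniteProducts (ScalarExt.coalg k k'),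
      ScalarExt.PreservesBinaryProducts (ScalarExt.coalg k k'),
      -- finite, resp. binary, powers of coalgebras are preserved
      ScalarExt.PreservesFinitePowers (ScalarExt.coalg k k'),
      ScalarExt.PreservesBinaryPowers (ScalarExt.coalg k k'),
      -- finite limits, finite products, binary products of bialgebras are preserved
      PreservesFiniteLimits (ScalarExt.bialg k k'),
      PreservesFiniteProducts (ScalarExt.bialg k k'),
      ScalarExt.PreservesBinaryProducts (ScalarExt.bialg k k'),
      -- finite limits, finite products, binary products of Hopf algebras are preserved
      PreservesFiniteLimits (ScalarExt.hopf k k'),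
      PreservesFiniteProducts (ScalarExt.hopf k k'),
      ScalarExt.PreservesBinaryProducts (ScalarExt.hopf k k'),
      -- finite, resp. binary, powers of bialgebras are preserved
      ScalarExt.PreservesFinitePowers (ScalarExt.bialg k k'),
      ScalarExt.PreservesBinaryPowers (ScalarExt.bialg k k'),
      -- finite, resp. binary, powers of Hopf algebras are preserved
      ScalarExt.PreservesFinitePowers (ScalarExt.hopf k k'),
      ScalarExt.PreservesBinaryPowers (ScalarExt.hopf k k'),
      -- the binary power of some Hopf algebra of finite dimension `> 1` is preserved
      ∃ H : HopfAlgCat.{u} k, FiniteDimensional k H ∧ 1 < Module.finrank k H ∧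
        ScalarExt.PreservesBinaryPower (ScalarExt.hopf k k') H,
      -- the binary power of some coalgebra of finite dimension `> 1` is preserved
      ∃ C : CoalgCat.{u} k, FiniteDimensional k C ∧ 1 < Module.finrank k C ∧
        ScalarExt.PreservesBinaryPower (ScalarExt.coalg k k') C] := by
  have hfd : FiniteDimensional k (ScalarExt.GroupAlgebraTwo k) :=
    Module.finite_of_finrank_pos (by simp [ScalarExt.finrank_groupAlgebraTwo])
  have hdim : 1 < Module.finrank k (ScalarExt.GroupAlgebraTwo k) := by
    simp [ScalarExt.finrank_groupAlgebraTwo]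
  -- A Hopf algebra of dimension two in every characteristic: it turns each universally quantified
  -- condition into an existential one.
  let A : HopfAlgCat.{u} k := HopfAlgCat.of k (ScalarExt.GroupAlgebraTwo k)
  tfae_have 1 → 4 := fun _ => ScalarExt.preservesFiniteLimits_coalg k k'
  tfae_have 4 → 5 := fun _ => inferInstance
  tfae_have 5 → 6 := fun _ => ScalarExt.preservesBinaryProducts_of_preservesFiniteProducts
  tfae_have 6 → 8 := fun h => h.preservesBinaryPowers
  tfae_have 8 → 20 := fun h => ⟨CoalgCat.of k A, hfd, hdim, h _⟩
  tfae_have 20 → 1 := fun ⟨C, _, hC, h⟩ =>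
    ScalarExt.isAlgebraic_of_preservesBinaryPower C hC h
  tfae_have 5 → 2 := fun _ _ _ _ _ => inferInstance
  tfae_have 2 → 3 := fun h X Y hX hY => by
    let P : WalkingPair → CoalgCat.{u} k := fun j => WalkingPair.casesOn j X Y
    exact h WalkingPair P (by rintro (_ | _) <;> assumption)
  tfae_have 3 → 20 := fun h => ⟨CoalgCat.of k A, hfd, hdim, h _ _ hfd hfd⟩
  tfae_have 5 → 7 := fun _ => ScalarExt.preservesFinitePowers_of_preservesFiniteProducts
  tfae_have 7 → 8 := fun h => h.preservesBinaryPowers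
  tfae_have 4 → 9 := fun _ =>
    ⟨fun _ _ _ => ⟨fun {K} => (ScalarExt.preservesLimit_bialg_iff K).2 inferInstance⟩⟩
  tfae_have 9 → 10 := fun _ => inferInstance
  tfae_have 10 → 11 := fun _ => ScalarExt.preservesBinaryProducts_of_preservesFiniteProducts
  tfae_have 11 → 16 := fun h => h.preservesBinaryPowers
  tfae_have 10 → 15 := fun _ => ScalarExt.preservesFinitePowers_of_preservesFiniteProducts
  tfae_have 15 → 16 := fun h => h.preservesBinaryPowers
  tfae_have 16 → 20 := fun h => ⟨CoalgCat.of k A, hfd, hdim,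
    ScalarExt.preservesBinaryPower_coalg_of_bialg (h (BialgCat.of k A))⟩
  tfae_have 4 → 12 := fun _ =>
    ⟨fun _ _ _ => ⟨fun {K} => (ScalarExt.preservesLimit_hopf_iff K).2 inferInstance⟩⟩
  tfae_have 12 → 13 := fun _ => inferInstance
  tfae_have 13 → 14 := fun _ => ScalarExt.preservesBinaryProducts_of_preservesFiniteProducts
  tfae_have 14 → 18 := fun h => h.preservesBinaryPowers
  tfae_have 13 → 17 := fun _ => ScalarExt.preservesFinitePowers_of_preservesFiniteProducts
  tfae_have 17 → 18 := fun h => h.preservesBinaryPowers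
  tfae_have 18 → 19 := fun h => ⟨A, hfd, hdim, h A⟩
  tfae_have 19 → 20 := fun ⟨H, hH, hH', h⟩ => ⟨CoalgCat.of k H, hH, hH',
    ScalarExt.preservesBinaryPower_coalg_of_hopf h⟩
  tfae_finish
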